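/- Let $M\cong\mathbb{Z}^d$ be a lattice with dual $N=\mathrm{Hom}(M,\mathbb{Z})$, let $A\subset M$ be a finite set and assume that $Q=\mathrm{Conv}(A)\subset M_{\mathbb R}$ is full-dimensional. For each facet $F$ of $Q$ let $n_F\in N$ be its primitive inward normal vector. Let $U_Q\subset\mathbb{C}^{\{\text{facets}\}}$ be the union, over the cones $\sigma$ of the normal fan of $Q$, of the open sets $\{x : x_F\neq 0 \text{ for all } F \text{ with } n_F\notin\sigma\}$, let $G_Q$ be the kernel of the homomorphism of tori $(\mathbb{C}^*)^{\{\text{facets}\}}\to N\otimes\mathbb{C}^*$, $(t_F)\mapsto\prod_F n_F\otimes t_F$, and let $\mathcal{X}_Q=[U_Q/G_Q]$ be the toric stack of $Q$, with toric divisors $\mathcal{D}_F=\{x_F=0\}$. For $\alpha\in A$ let $s_\alpha=\prod_F x_F^{\langle n_F,\alpha\rangle-\min_Q n_F}$ be the corresponding section of $\mathcal{O}_Q(1)$, and let $\mathcal{L}_A=\{s=\sum_{\alpha\in A}c_\alpha s_\alpha\}$, regarded as the affine space with coordinates $c_\alpha$. The locus of full sections is $$\mathcal{L}_A^{\mathrm{full}}=\{s=\textstyle\sum_\alpha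 c_\alpha s_\alpha : c_\alpha\neq 0\text{ for every vertex }\alpha\text{ of }Q\}.$$ For a (Zariski) open subset $U\subset\mathcal{L}_A$ and a set $J$ of facets (possibly empty) let $$\mathcal{I}_J(U)=\{(s,y)\in U\times\mathcal{X}_Q : s(y)=0,\ y\in\mathcal{D}_F\text{ for all }F\in J\},$$ a closed substack of $U\times\mathcal{X}_Q$ defined by the vanishing of $s$ and of the $x_F$, $F\in J$. Then $\mathcal{L}_A^{\mathrm{full}}$ is the largest open subset $U$ of $\mathcal{L}_A$ such that the projection $\mathcal{I}_J(U)\to U$ is flat for all sets $J$ of facets: the projections $\mathcal{I}_J(\mathcal{L}_A^{\mathrm{full}})\to\mathcal{L}_A^{\mathrm{full}}$ are flat for all $J$, and every open $U\subset\mathcal{L}_A$ for which $\mathcal{I}_J(U)\to U$ is flat for all $J$ is contained in $\mathcal{L}_A^{\mathrm{full}}$. -/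

import Mathlib

open CategoryTheory MonoidalCategory CartesianMonoidalCategory AlgebraicGeometry
open scoped TensorProduct

noncomputable section

namespace ToricIncidence

/-! ### The marked polytope `(Q, A)` and the facet normals -/

section Polytope

variable {M : Type} [AddCommGroup M]

/-- The real vector space `M ⊗ ℝ`. -/
abbrev RealSpan (M : Type) [AddCommGroup M] : Type := ℝ ⊗[ℤ] M

/-- The inclusion of the lattice in `M ⊗ ℝ`. -/
def latticePoint (m : M) : RealSpan M := (1 : ℝ) ⊗ₜ[ℤ] m

/-- The linear functional on `M ⊗ ℝ` given by an element of the dual lattice `N`. -/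
def realFunctional (n : Module.Dual ℤ M) : RealSpan M →ₗ[ℝ] ℝ :=
  n.baseChange ℝ

lemma realFunctional_latticePoint (n : Module.Dual ℤ M) (m : M) :
    realFunctional n (latticePoint m) = (n m : ℝ) := by
  simp [realFunctional, latticePoint]

/-- The polytope `Q = Conv(A)`. -/
def polytope (A : Finset M) : Set (RealSpan M) :=
  convexHull ℝ (latticePoint '' (A : Set M))

/-- The lattice points of `A` that are vertices of `Q`. -/
def IsVertex (A : Finset M) (a : M) : Prop :=
  a ∈ A ∧ latticePoint a ∈ (polytope A).extremePoints ℝ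

/-- The face of `Q` on which `n` attains its minimum. -/
def supportFace (A : Finset M) (n : Module.Dual ℤ M) : Set (RealSpan M) :=
  {q ∈ polytope A | ∀ q' ∈ polytope A, realFunctional n q ≤ realFunctional n q'}

/-- `n` is the primitive inward normal vector to a facet (a face of codimension one) of `Q`. -/
structure IsFacetNormal (A : Finset M) (n : Module.Dual ℤ M) : Prop where
  primitive : ∀ (k : ℤ) (n' : Module.Dual ℤ M), n = k • n' → IsUnit k
  codim_one : Module.finrank ℝ (vectorSpan ℝ (supportFace A n)) + 1 = Module.finrank ℤ M

/-- The set of primitive normal vectors to the facets of `Q`;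
it indexes the facets, and the toric divisors `D_i`. -/
def FacetNormal (A : Finset M) : Type := {n : Module.Dual ℤ M // IsFacetNormal A n}

/-- The cone of the normal fan of `Q` attached to a point `p` of `Q`: the functionals that attain
their minimum on `Q` at `p`. It only depends on the smallest face containing `p`, and every cone
of the normal fan is of this form. -/
def normalCone (A : Finset M) (p : RealSpan M) : Set (Module.Dual ℝ (RealSpan M)) :=
  {n | ∀ q ∈ polytope A, n p ≤ n q}

/-- The lattice distance of `a` from the facet with normal `n`. -/
def facetDistance (A : Finset M) (n : FacetNormal A) (a : M) : ℕ :=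
  (n.1 a - ⨅ b : A, n.1 b).toNat

end Polytope

end ToricIncidence

namespace ToricIncidence

/-! ### Finiteness of the set of facets -/

section Finiteness

variable {M : Type} [AddCommGroup M]

lemma supportFace_subset (A : Finset M) (n : Module.Dual ℤ M) :
    supportFace A n ⊆ convexHull ℝ (latticePoint '' {a : M | a ∈ A ∧ ∀ b ∈ A, n a ≤ n b}) := by
  classical
  rintro q ⟨hq, hmin⟩
  have hb : ∀ b ∈ A, realFunctional n q ≤ n b := fun b hb => by
    rw [← realFunctional_latticePoint]
    exact hmin _ (subset_convexHull ℝ _ ⟨b, hb, rfl⟩)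
  rw [polytope, ← Finset.coe_image, Finset.mem_convexHull'] at hq
  obtain ⟨w, hw0, hw1, hwq⟩ := hq
  have key : ∀ y ∈ A.image latticePoint, w y * (realFunctional n y - realFunctional n q) = 0 := by
    rw [← Finset.sum_eq_zero_iff_of_nonneg]
    · simp only [mul_sub, Finset.sum_sub_distrib, ← Finset.sum_mul, hw1, one_mul]
      conv_lhs => rw [← hwq]
      simp
    · intro y hy
      obtain ⟨b, hbA, rfl⟩ := Finset.mem_image.1 hy
      refine mul_nonneg (hw0 _ hy) ?_
      rw [realFunctional_latticePoint]
      linarith [hb b hbA]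
  rw [← hwq]
  rw [← Finset.sum_filter_of_ne (p := fun y => w y ≠ 0)]
  swap
  · intro y _ h h0
    exact h (by simp [h0])
  refine (convex_convexHull ℝ _).sum_mem ?_ ?_ ?_
  · intro y hy
    exact hw0 y (Finset.mem_filter.1 hy).1
  · rw [Finset.sum_filter_ne_zero, hw1]
  · intro y hy
    obtain ⟨hy, hne⟩ := Finset.mem_filter.1 hy
    have h := (mul_eq_zero.1 (key y hy)).resolve_left hne
    obtain ⟨a, haA, rfl⟩ := Finset.mem_image.1 hy
    refine subset_convexHull ℝ _ ⟨a, ⟨haA, fun b hbA => ?_⟩, rfl⟩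
    rw [realFunctional_latticePoint] at h
    have := hb b hbA
    have h2 : (n a : ℝ) ≤ n b := by linarith
    exact_mod_cast h2

lemma eq_or_eq_neg_of_primitive [Module.Free ℤ M] {n n' : Module.Dual ℤ M}
    (hn : ∀ (k : ℤ) (m : Module.Dual ℤ M), n = k • m → IsUnit k)
    (hn' : ∀ (k : ℤ) (m : Module.Dual ℤ M), n' = k • m → IsUnit k)
    {a b : ℤ} (ha : a ≠ 0) (h : a • n' = b • n) : n' = n ∨ n' = -n := by
  have key : ∀ {n n' : Module.Dual ℤ M} {a b : ℤ}, IsCoprime a b → a • n' = b • n →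
      ∃ m : Module.Dual ℤ M, n = a • m := by
    intro n n' a b hab h
    obtain ⟨u, v, huv⟩ := hab
    refine ⟨u • n + v • n', ?_⟩
    rw [smul_add, smul_smul, smul_comm, h, smul_smul, ← add_smul]
    rw [show a * u + v * b = 1 by linarith, one_smul]
  obtain ⟨g, a', b', hg, hcop, rfl, rfl⟩ : ∃ g a' b' : ℤ, g ≠ 0 ∧ IsCoprime a' b' ∧
      a = g * a' ∧ b = g * b' := by
    have hg : (Int.gcd a b : ℤ) ≠ 0 := by simp [Int.gcd_eq_zero_iff, ha]
    refine ⟨Int.gcd a b, a / Int.gcd a b, b / Int.gcd a b, hg, ?_, ?_, ?_⟩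
    · rw [Int.isCoprime_iff_gcd_eq_one]
      exact Int.gcd_ediv_gcd_ediv_gcd (by
        have := hg; positivity)
    · exact (Int.mul_ediv_cancel' (Int.gcd_dvd_left ..)).symm
    · exact (Int.mul_ediv_cancel' (Int.gcd_dvd_right ..)).symm
  rw [mul_smul, mul_smul] at h
  have h := smul_right_injective _ hg h
  obtain ⟨m, hm⟩ := key hcop h
  obtain ⟨m', hm'⟩ := key hcop.symm h.symm
  rcases Int.isUnit_iff.1 (hn _ _ hm) with ha' | ha' <;>
    rcases Int.isUnit_iff.1 (hn' _ _ hm') with hb' | hb' <;>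
    rw [ha', hb'] at h <;>
    simp only [one_smul, neg_smul, neg_inj] at h <;>
    first
    | exact Or.inl h
    | exact Or.inr h
    | exact Or.inr (by rw [← h, neg_neg])

instance FacetNormal.finite [Module.Free ℤ M] [Module.Finite ℤ M] (A : Finset M) :
    Finite (FacetNormal A) := by
  classical
  have : Set.Finite {n : Module.Dual ℤ M | IsFacetNormal A n} := by
    refine Set.Finite.of_finite_fibers
      (fun n : Module.Dual ℤ M => A.filter (fun a => ∀ b ∈ A, n a ≤ n b))
      (Set.Finite.subset (A.powerset : Finset (Finset M)).finite_toSet ?_) ?_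
    · rintro _ ⟨n, -, rfl⟩
      exact Finset.mem_coe.2 (Finset.mem_powerset.2 (Finset.filter_subset _ _))
    · rintro _ ⟨n, hn, rfl⟩
      refine Set.Finite.subset (Set.toFinite {n, -n}) ?_
      rintro n' ⟨hn', heq⟩
      simp only [Set.mem_preimage, Set.mem_singleton_iff] at heq
      simp only [Set.mem_insert_iff, Set.mem_singleton_iff]
      set B := A.filter (fun a => ∀ b ∈ A, n a ≤ n b) with hB
      let W : Submodule ℝ (RealSpan M) := vectorSpan ℝ (latticePoint '' (B : Set M))
      have hW : ∀ k : Module.Dual ℤ M, A.filter (fun a => ∀ b ∈ A, k a ≤ k b) = B →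
          W ≤ LinearMap.ker (realFunctional k) := by
        intro k hk
        refine Submodule.span_le.2 ?_
        rintro _ ⟨_, ⟨a, ha, rfl⟩, _, ⟨b, hb, rfl⟩, rfl⟩
        rw [← hk] at ha hb
        simp only [Finset.coe_filter, Set.mem_ofPred_eq] at ha hb
        have := le_antisymm (ha.2 b hb.1) (hb.2 a ha.1)
        simp [realFunctional_latticePoint, this]
      have hdim : Module.finrank ℤ M ≤ Module.finrank ℝ W + 1 := by
        rw [← hn.codim_one]
        gcongr
        have hsub : supportFace A n ⊆ convexHull ℝ (latticePoint '' (B : Set M)) := by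
          simpa [hB, Finset.coe_filter] using supportFace_subset A n
        refine Submodule.finrank_mono ((vectorSpan_mono ℝ hsub).trans ?_)
        rw [← direction_affineSpan, affineSpan_convexHull, direction_affineSpan]
      have hne : ∀ k : Module.Dual ℤ M, IsFacetNormal A k → ∃ m, k m ≠ 0 := by
        intro k hk
        by_contra! h
        have := hk.primitive 0 0 (by ext m; simp [h])
        simp at this
      obtain ⟨e, he⟩ := hne n hn
      refine eq_or_eq_neg_of_primitive hn.primitive hn'.primitive he (b := n' e) ?_
      set δ := n e • n' - n' e • n with hδ
      have hWδ : W ⊔ (ℝ ∙ latticePoint e) ≤ LinearMap.ker (realFunctional δ) := by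
        have hlin : realFunctional δ =
            (n e : ℝ) • realFunctional n' - (n' e : ℝ) • realFunctional n := by
          ext m
          simp [realFunctional, hδ]
        rw [hlin]
        refine sup_le ?_ ?_
        · intro x hx
          have h1 := hW n rfl hx
          have h2 := hW n' heq hx
          rw [LinearMap.mem_ker] at h1 h2 ⊢
          simp [h1, h2]
        · rw [Submodule.span_singleton_le_iff_mem, LinearMap.mem_ker]
          simp [realFunctional_latticePoint]
          ring
      have hlt : W < W ⊔ (ℝ ∙ latticePoint e) := by
        refine lt_of_le_of_ne le_sup_left fun h => he ?_
        have : latticePoint e ∈ W := by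
          rw [h]
          exact Submodule.mem_sup_right (Submodule.mem_span_singleton_self _)
        have := hW n rfl this
        rw [LinearMap.mem_ker, realFunctional_latticePoint] at this
        exact_mod_cast this
      have htop : W ⊔ (ℝ ∙ latticePoint e) = ⊤ := by
        apply Submodule.eq_top_of_finrank_eq
        have h1 := Submodule.finrank_lt_finrank_of_lt hlt
        have h2 := Submodule.finrank_le (W ⊔ (ℝ ∙ latticePoint e))
        have h3 : Module.finrank ℝ (RealSpan M) = Module.finrank ℤ M :=
          Module.finrank_baseChange
        omega
      rw [htop] at hWδ
      rw [← sub_eq_zero]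
      ext m
      have : realFunctional δ (latticePoint m) = 0 := hWδ trivial
      rw [realFunctional_latticePoint] at this
      exact_mod_cast this
  exact this.to_subtype

end Finiteness

end ToricIncidence

namespace ToricIncidence

/-! ### Flat morphisms from a stack to a scheme

A stack over a scheme `B` is given by the functor `p : 𝒳 ⥤ Over B` of its category of objects,
all of whose arrows are cartesian. An object `ξ` over `T` is the same thing as a morphism `T ⟶ 𝒳`,
and the `2`-fibre product of the morphisms given by `ξ` over `T` and `η` over `T'` is the scheme
underlying the product of `ξ` and `η` in the category `𝒳`. -/

section Stack

open Limits

variable {B : Scheme.{0}} {𝒳 : Type 1} [Category.{0} 𝒳]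

/-- The morphism from a scheme to `𝒳` given by the object `ξ` is representable by schemes, flat,
surjective and locally of finite presentation, i.e. it is a flat atlas of `𝒳`. -/
def IsAtlas (p : 𝒳 ⥤ Over B) (ξ : 𝒳) : Prop :=
  ∀ η : 𝒳, ∃ c : BinaryFan ξ η, Nonempty (IsLimit c) ∧
    Flat (p.map c.snd).left ∧ Surjective (p.map c.snd).left ∧
    LocallyOfFinitePresentation (p.map c.snd).left

/-- The morphism from a stack to a scheme is flat: it becomes flat on some atlas
(equivalently on every atlas, since flatness is local on the source for flat covers). -/
def IsFlatOver (p : 𝒳 ⥤ Over B) : Prop :=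
  ∃ ξ : 𝒳, IsAtlas p ξ ∧ Flat (p.obj ξ).hom

end Stack

/-! ### Principal bundles -/

/-- The base scheme `Spec ℂ`. -/
abbrev baseScheme : Scheme.{0} := Spec (.of ℂ)

/-- The algebra homomorphism on global functions induced by a morphism of schemes over `ℂ`. -/
def pull {X Y : Over baseScheme} (f : X ⟶ Y) : Γ(Y.left, ⊤) →+* Γ(X.left, ⊤) :=
  f.left.appTop.hom

section Torsor

variable (G : Over baseScheme) [GrpObj G]

/-- The action map `G × P ⟶ P`. -/
def actionMap (P : Over baseScheme) [ModObj G P] : G ⊗ P ⟶ P := ModObj.smul (M := G) (X := P)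

/-- `π : P ⟶ T` is a principal `G`-bundle: it is a flat cover, it is invariant, and
`(g, y) ↦ (g • y, y)` is an isomorphism from `G × P` to `P ×_T P`. -/
structure IsPrincipalBundle {P T : Over baseScheme} [ModObj G P] (π : P ⟶ T) : Prop where
  flat : Flat π.left
  surjective : Surjective π.left
  locallyOfFinitePresentation : LocallyOfFinitePresentation π.left
  isPullback : IsPullback (actionMap G P) (snd G P) π π

end Torsor

/-! ### The toric stack `[U_Q / G_Q]` -/

section ToricStack

variable {M : Type} [AddCommGroup M]

/-- The homomorphism `M ⟶ ℤ^{facets}` dual to `e_F ↦ n_F`. -/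
def divMap (A : Finset M) : M →+ (FacetNormal A → ℤ) where
  toFun m F := F.1 m
  map_zero' := by ext; simp
  map_add' := by intros; ext; simp

/-- The cokernel of `M ⟶ ℤ^{facets}`. -/
abbrev DivClassGroup (A : Finset M) : Type := (FacetNormal A → ℤ) ⧸ (divMap A).range

/-- The group `G_Q`, i.e. the kernel of the homomorphism of tori
`(ℂ^*)^{facets} ⟶ N ⊗ ℂ^*`: the diagonalizable group whose character group is
the cokernel of `M ⟶ ℤ^{facets}`. -/
abbrev toricGroup (A : Finset M) : Over baseScheme :=
  (Spec (.of (MonoidAlgebra ℂ (Multiplicative (DivClassGroup A))))).asOver baseScheme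

/-- The `F`-th coordinate of the inclusion of `G_Q` in the torus `(ℂ^*)^{facets}`. -/
def groupCoord (A : Finset M) (F : FacetNormal A) : Γ((toricGroup A).left, ⊤) := by
  classical
  exact (Scheme.ΓSpecIso _).inv.hom
    (MonoidAlgebra.of ℂ (Multiplicative (DivClassGroup A))
      (.ofAdd (QuotientAddGroup.mk (Pi.single F 1))))

/-- The open toric variety `U_Q` in the affine space `ℂ^{facets}`: the union over the cones `σ` of
the normal fan of the open sets on which `x_F ≠ 0` for all `F ∉ σ`. -/
def coxOpen (A : Finset M) : (𝔸(FacetNormal A; baseScheme)).Opens :=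
  ⨆ p : polytope A, ⨅ F : {F : FacetNormal A // realFunctional F.1 ∉ normalCone A p},
    (𝔸(FacetNormal A; baseScheme)).basicOpen (AffineSpace.coord baseScheme F.1)

/-- `U_Q` as a scheme over `ℂ`. -/
def coxScheme (A : Finset M) : Over baseScheme :=
  Over.mk ((coxOpen A).ι ≫ (𝔸(FacetNormal A; baseScheme) ↘ baseScheme))

/-- The coordinate function `x_F` on `U_Q`, the equation of the toric divisor `D_F`. -/
def coxCoord (A : Finset M) (F : FacetNormal A) : Γ((coxScheme A).left, ⊤) :=
  (coxOpen A).ι.appTop.hom (AffineSpace.coord baseScheme F)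

/-- An object over the scheme `T` of the toric stack `𝒳_Q = [U_Q / G_Q]`: a principal
`G_Q`-bundle `P` over `T` with an equivariant morphism `P ⟶ U_Q`, where `G_Q` acts on `U_Q`
through `(ℂ^*)^{facets}` by scaling the coordinates. -/
structure ToricStack (A : Finset M) : Type 1 where
  base : Over baseScheme
  total : Over baseScheme
  [action : ModObj (toricGroup A) total]
  proj : total ⟶ base
  isPrincipalBundle : IsPrincipalBundle (toricGroup A) proj
  toCox : total ⟶ coxScheme A
  equivariant : ∀ F : FacetNormal A,
    pull (actionMap (toricGroup A) total) (pull toCox (coxCoord A F)) =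
      pull (fst (toricGroup A) total) (groupCoord A F) *
        pull (snd (toricGroup A) total) (pull toCox (coxCoord A F))

attribute [instance] ToricStack.action

namespace ToricStack

variable {A : Finset M}

/-- An arrow of `𝒳_Q` over `T ⟶ T'`: an equivariant cartesian square of principal bundles,
compatible with the morphisms to `U_Q`. -/
@[ext]
structure Hom (X Y : ToricStack A) : Type where
  base : X.base ⟶ Y.base
  total : X.total ⟶ Y.total
  smul_total : actionMap (toricGroup A) X.total ≫ total =
    (toricGroup A ◁ total) ≫ actionMap (toricGroup A) Y.total
  isPullback : IsPullback total X.proj Y.proj base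
  total_toCox : total ≫ Y.toCox = X.toCox

instance : Category.{0} (ToricStack A) where
  Hom X Y := Hom X Y
  id X :=
    { base := 𝟙 _
      total := 𝟙 _
      smul_total := by simp
      isPullback := IsPullback.of_id_fst
      total_toCox := by simp }
  comp {X Y Z} f g :=
    { base := f.base ≫ g.base
      total := f.total ≫ g.total
      smul_total := by
        rw [← Category.assoc, f.smul_total, Category.assoc, g.smul_total,
          MonoidalCategory.whiskerLeft_comp, Category.assoc]
      isPullback := f.isPullback.paste_horiz g.isPullback
      total_toCox := by rw [Category.assoc, g.total_toCox, f.total_toCox] }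
  id_comp f := Hom.ext (Category.id_comp f.base) (Category.id_comp f.total)
  comp_id f := Hom.ext (Category.comp_id f.base) (Category.comp_id f.total)
  assoc f g h := Hom.ext (Category.assoc f.base g.base h.base)
    (Category.assoc f.total g.total h.total)

@[simp] lemma id_base (X : ToricStack A) : Hom.base (𝟙 X) = 𝟙 X.base := rfl

@[simp] lemma comp_base {X Y Z : ToricStack A} (f : X ⟶ Y) (g : Y ⟶ Z) :
    Hom.base (f ≫ g) = Hom.base f ≫ Hom.base g := rfl

end ToricStack

end ToricStack

/-! ### The linear system and the incidence stacks -/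

section Incidence

variable {M : Type} [AddCommGroup M]

/-- The linear system `𝓛_A`, the span of the sections `s_a` for `a ∈ A`, as the affine space with
coordinates `c_a`; its points are the sections `∑ c_a s_a`. -/
abbrev linearSystem (A : Finset M) : Scheme.{0} := 𝔸(A; baseScheme)

/-- The locus of full sections: `c_a ≠ 0` for all vertices `a` of `Q`. -/
def fullSections (A : Finset M) : (linearSystem A).Opens :=
  ⨅ a : {a : A // IsVertex A a.1},
    (linearSystem A).basicOpen (AffineSpace.coord baseScheme a.1)

/-- An open subset of the linear system as a scheme over `ℂ`. -/
def openScheme {A : Finset M} (U : (linearSystem A).Opens) : Over baseScheme :=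
  Over.mk (U.ι ≫ (linearSystem A ↘ baseScheme))

/-- The coefficient `c_a` as a function on `U`. -/
def coeff {A : Finset M} (U : (linearSystem A).Opens) (a : A) : Γ((openScheme U).left, ⊤) :=
  U.ι.appTop.hom (AffineSpace.coord baseScheme a)

variable [Module.Free ℤ M] [Module.Finite ℤ M]

/-- The section `s_a` of `𝒪_Q(1)`, as a (semi-invariant) function on `U_Q`: the monomial in which
the exponent of `x_F` is the lattice distance of `a` from the facet `F`. -/
def toricSection (A : Finset M) (a : M) : Γ((coxScheme A).left, ⊤) :=
  letI := Fintype.ofFinite (FacetNormal A)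
  ∏ F : FacetNormal A, coxCoord A F ^ facetDistance A F a

/-- An object over the scheme `T` of the incidence stack `ℐ_J(U)`, the closed substack of
`U × 𝒳_Q` of all `(s, y)` such that `s` vanishes at `y` and `y` is in `D_j` for all `j ∈ J`. -/
structure IncidenceStack (A : Finset M) (J : Set (FacetNormal A)) (U : (linearSystem A).Opens) :
    Type 1 where
  point : ToricStack A
  sec : point.base ⟶ openScheme U
  mem_hypersurface :
    ∑ a : A, pull (point.proj ≫ sec) (coeff U a) * pull point.toCox (toricSection A a.1) = 0
  mem_divisor : ∀ F ∈ J, pull point.toCox (coxCoord A F) = 0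

namespace IncidenceStack

variable {A : Finset M} {J : Set (FacetNormal A)} {U : (linearSystem A).Opens}

/-- An arrow of `ℐ_J(U)`. -/
@[ext]
structure Hom (X Y : IncidenceStack A J U) : Type where
  point : X.point ⟶ Y.point
  base_sec : ToricStack.Hom.base point ≫ Y.sec = X.sec

instance : Category.{0} (IncidenceStack A J U) where
  Hom X Y := Hom X Y
  id X := { point := 𝟙 _, base_sec := by simp }
  comp f g :=
    { point := f.point ≫ g.point
      base_sec := by rw [ToricStack.comp_base, Category.assoc, g.base_sec, f.base_sec] }
  id_comp f := Hom.ext (Category.id_comp f.point)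
  comp_id f := Hom.ext (Category.comp_id f.point)
  assoc f g h := Hom.ext (Category.assoc f.point g.point h.point)

end IncidenceStack

/-- The projection `ℐ_J(U) ⟶ U`. -/
def incidenceProj (A : Finset M) (J : Set (FacetNormal A)) (U : (linearSystem A).Opens) :
    IncidenceStack A J U ⥤ Over (U : Scheme.{0}) where
  obj X := Over.mk X.sec.left
  map f := Over.homMk f.point.base.left (by
    have := congrArg (fun k => k.left) f.base_sec
    exact this)
  map_id X := rfl
  map_comp f g := rfl

end Incidence

end ToricIncidence

end

noncomputable section

namespace ToricIncidence

/-! ### Trivial principal bundles. -/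

section GroupAction

open MonObj

variable {G : Over baseScheme} [GrpObj G]

/-! Flatness on full sections is tested on an explicit atlas. For `U` with affine underlying scheme,
`exists_classifying` constructs the scheme `T` of incident pairs: an open subscheme of the spectrum
of R[x_F : F ∉ J]/(f_J), where R is the ring of functions on `U` and f_J is the universal section Σ
c_a s_a restricted to x_F = 0 for F ∈ J. The product of the trivial bundle over `T` with an object
`E` of the incidence stack is the trivial bundle on the total space of `E`, and its projection to
`E` is the bundle projection of `E`, a flat cover (`IncidenceStack.isAtlas_ofHom`). So the trivial
bundle over `T` is an atlas, and it suffices that `T` is flat over `U`.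

If `T` is empty there is nothing to prove. Otherwise the facets in J have a common vertex v
(`exists_isVertex_of_mem_normalCone`). Give x_F weight 1 if F passes through v and weight 0 if not.
The monomial of v has weight 0, and every other surviving monomial has positive weight, because each
other element of A is off some facet through v (`IsVertex.exists_facet`). Thus the part of f_J of
lowest weight is a single monomial with coefficient c_v, a unit over the full sections. Such a
polynomial is a nonzerodivisor modulo every ideal of R, which gives flatness of the quotient
(`flat_quotient_span_singleton`).

Conversely, let c_v vanish at a point of `U` for some vertex v, and let J be the set of all facets
through v. On the corresponding stratum s_v is invertible and all other s_b are zero, so the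
incidence stack is nonempty and lies over c_v = 0. A flat morphism from a nonempty scheme to an
integral scheme cannot factor through the zero locus of a nonzero function (`eq_zero_of_flat`), so
the projection is not flat. -/

lemma lift_actionMap_assoc {P Y : Over baseScheme} [ModObj G P] (g h : Y ⟶ G) (p : Y ⟶ P) :
    lift g (lift h p ≫ actionMap G P) ≫ actionMap G P = lift (g * h) p ≫ actionMap G P := by
  have h1 : μ[G] ▷ P ≫ actionMap G P = (α_ G G P).hom ≫ (G ◁ actionMap G P) ≫ actionMap G P :=
    ModObj.mul_smul (M := G) P
  have h2 := congrArg (lift (lift g h) p ≫ ·) h1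
  simp only [lift_whiskerRight_assoc, lift_lift_associator_hom_assoc, lift_whiskerLeft_assoc] at h2
  exact h2.symm

lemma lift_one_actionMap {P Y : Over baseScheme} [ModObj G P] (p : Y ⟶ P) :
    lift (1 : Y ⟶ G) p ≫ actionMap G P = p := by
  have h1 : η[G] ▷ P ≫ actionMap G P = (λ_ P).hom := ModObj.one_smul (M := G) P
  have h2 := congrArg (lift (toUnit Y) p ≫ ·) h1
  simpa [Hom.one_def] using h2

variable (G) in
/-- The action of `G` on `G × T` by multiplication on the first factor. -/
@[reducible] def trivialAction (T : Over baseScheme) : ModObj G (G ⊗ T) where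
  smul := (α_ G G T).inv ≫ μ[G] ▷ T
  one_smul := by
    change η[G] ▷ (G ⊗ T) ≫ (α_ G G T).inv ≫ μ[G] ▷ T = (λ_ (G ⊗ T)).hom
    rw [associator_inv_naturality_left_assoc, ← comp_whiskerRight, MonObj.one_mul]
    simp
  mul_smul := by
    change μ[G] ▷ (G ⊗ T) ≫ (α_ G G T).inv ≫ μ[G] ▷ T = (α_ G G (G ⊗ T)).hom ≫
      G ◁ ((α_ G G T).inv ≫ μ[G] ▷ T) ≫ (α_ G G T).inv ≫ μ[G] ▷ T
    rw [associator_inv_naturality_left_assoc, ← comp_whiskerRight, MonObj.mul_assoc]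
    simp

lemma lift_trivialAction {T Y : Over baseScheme} (g h : Y ⟶ G) (t : Y ⟶ T) :
    letI := trivialAction G T
    lift g (lift h t) ≫ actionMap G (G ⊗ T) = lift (g * h) t := by
  change lift g (lift h t) ≫ (α_ G G T).inv ≫ μ[G] ▷ T = lift (g * h) t
  simp [Hom.mul_def]

lemma actionMap_trivialAction (T : Over baseScheme) :
    letI := trivialAction G T
    actionMap G (G ⊗ T) =
      lift (fst G (G ⊗ T) * (snd G (G ⊗ T) ≫ fst G T)) (snd G (G ⊗ T) ≫ snd G T) := by
  rw [← lift_trivialAction]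
  have : lift (fst G (G ⊗ T)) (lift (snd G (G ⊗ T) ≫ fst G T) (snd G (G ⊗ T) ≫ snd G T)) =
    𝟙 _ := by ext1 <;> simp
  rw [this, Category.id_comp]

/-- Two points of `G × T` over the same point of `T` differ by exactly one group element, the
quotient of their first coordinates. -/
lemma isPullback_trivialAction (T : Over baseScheme) :
    letI := trivialAction G T
    IsPullback (actionMap G (G ⊗ T)) (snd G (G ⊗ T)) (snd G T) (snd G T) := by
  let := trivialAction G T
  have act_eq := actionMap_trivialAction (G := G) T
  refine ⟨⟨by simp [act_eq]⟩, ⟨Limits.PullbackCone.IsLimit.mk _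
    (fun s => lift ((s.fst ≫ fst G T) * (s.snd ≫ fst G T)⁻¹) s.snd) ?_ ?_ ?_⟩⟩
  · intro s
    have hs : s.fst ≫ snd G T = s.snd ≫ snd G T := s.condition
    have : s.snd = lift (s.snd ≫ fst G T) (s.snd ≫ snd G T) := by ext1 <;> simp
    conv_lhs => rw [this]
    simp only [lift_fst]
    rw [lift_trivialAction, inv_mul_cancel_right, ← hs]
    ext1 <;> simp
  · intro s
    simp
  · intro s m h1 h2
    ext1
    · simp only [lift_fst]
      rw [eq_mul_inv_iff_mul_eq, ← h1, ← h2, act_eq]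
      simp [Hom.mul_def, comp_lift_assoc]
    · simpa using h2

omit [GrpObj G] in
lemma snd_left_property {W : MorphismProperty Scheme.{0}} [W.IsStableUnderBaseChange]
    (hG : W G.hom) (T : Over baseScheme) : W (snd G T).left := by
  exact MorphismProperty.pullback_snd _ _ hG

lemma isPrincipalBundle_snd [Flat G.hom] [Surjective G.hom] [LocallyOfFinitePresentation G.hom]
    (T : Over baseScheme) :
    letI := trivialAction G T
    IsPrincipalBundle G (snd G T) :=
  letI := trivialAction G T
  { flat := snd_left_property (W := @Flat) inferInstance T
    surjective := snd_left_property (W := @Surjective) inferInstance T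
    locallyOfFinitePresentation :=
      snd_left_property (W := @LocallyOfFinitePresentation) inferInstance T
    isPullback := isPullback_trivialAction T }

end GroupAction

/-! ### Morphisms to open subschemes of affine spaces. -/

section OpenInAffineSpace

lemma pull_comp {X Y Z : Over baseScheme} (f : X ⟶ Y) (g : Y ⟶ Z) (x : Γ(Z.left, ⊤)) :
    pull (f ≫ g) x = pull f (pull g x) := by
  simp only [pull, Over.comp_left, Scheme.Hom.comp_appTop]
  rfl

lemma mem_basicOpen_pull {X Y : Over baseScheme} (f : X ⟶ Y) (x : Γ(Y.left, ⊤)) (t : X.left) :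
    t ∈ X.left.basicOpen (pull f x) ↔ f.left t ∈ Y.left.basicOpen x := by
  rw [pull, ← Scheme.preimage_basicOpen_top]
  rfl

variable {n : Type} (W : (𝔸(n; baseScheme)).Opens)

/-- An open subscheme of an affine space, over the base. -/
abbrev openSubscheme : Over baseScheme := Over.mk (W.ι ≫ (𝔸(n; baseScheme) ↘ baseScheme))

/-- The coordinate functions on an open subscheme of an affine space. -/
def openCoord (i : n) : Γ((openSubscheme W).left, ⊤) :=
  W.ι.appTop.hom (AffineSpace.coord baseScheme i)

variable {W}

lemma openSubscheme_hom_ext {Y : Over baseScheme} {f g : Y ⟶ openSubscheme W}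
    (h : ∀ i, pull f (openCoord W i) = pull g (openCoord W i)) : f = g := by
  apply Over.OverMorphism.ext
  rw [← cancel_mono W.ι]
  refine AffineSpace.hom_ext ?_ fun i => ?_
  · have hf := Over.w f
    have hg := Over.w g
    simp only [Over.mk_hom] at hf hg
    rw [Category.assoc, Category.assoc, hf, hg]
  · rw [Scheme.Hom.comp_appTop, Scheme.Hom.comp_appTop]
    exact h i

/-- A tuple of functions is a morphism to affine space, and it factors through an open subscheme as
soon as its image does so as a set. -/
lemma exists_hom_openSubscheme {Y : Over baseScheme} (v : n → Γ(Y.left, ⊤))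
    (hv : ∀ y, AffineSpace.homOfVector Y.hom v y ∈ W) :
    ∃ f : Y ⟶ openSubscheme W, ∀ i, pull f (openCoord W i) = v i := by
  have hr : Set.range (AffineSpace.homOfVector Y.hom v) ⊆ Set.range W.ι := by
    rintro _ ⟨y, rfl⟩
    simpa using hv y
  refine ⟨Over.homMk (IsOpenImmersion.lift W.ι (AffineSpace.homOfVector Y.hom v) hr) ?_, ?_⟩
  · refine (Category.assoc _ _ _).symm.trans ?_
    rw [IsOpenImmersion.lift_fac]
    exact AffineSpace.homOfVector_over _ _
  · intro i
    have := congr(($(IsOpenImmersion.lift_fac W.ι (AffineSpace.homOfVector Y.hom v) hr)).appTop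
      (AffineSpace.coord baseScheme i))
    rw [AffineSpace.homOfVector_appTop_coord, Scheme.Hom.comp_appTop] at this
    exact this

lemma homOfVector_mem_basicOpen {Y : Scheme.{0}} (p : Y ⟶ baseScheme) (v : n → Γ(Y, ⊤)) (i : n)
    (y : Y) :
    AffineSpace.homOfVector p v y ∈ (𝔸(n; baseScheme)).basicOpen (AffineSpace.coord baseScheme i) ↔
      y ∈ Y.basicOpen (v i) := by
  conv_rhs => rw [← AffineSpace.homOfVector_appTop_coord p v i, ← Scheme.preimage_basicOpen_top]
  rfl

lemma openSubscheme_mem_basicOpen (i : n) (y : (openSubscheme W).left) :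
    y ∈ (openSubscheme W).left.basicOpen (openCoord W i) ↔
      W.ι y ∈ (𝔸(n; baseScheme)).basicOpen (AffineSpace.coord baseScheme i) := by
  rw [openCoord, ← Scheme.preimage_basicOpen_top]
  rfl

end OpenInAffineSpace

/-! ### The functor of points of U_Q. -/

section Cox

variable {M : Type} [AddCommGroup M] [Module.Free ℤ M] [Module.Finite ℤ M] {A : Finset M}

lemma mem_iInf_opens {ι : Type} [Finite ι] {X : Scheme.{0}} (U : ι → X.Opens) (x : X) :
    x ∈ ⨅ i, U i ↔ ∀ i, x ∈ U i := by
  rw [← SetLike.mem_coe, TopologicalSpace.Opens.coe_iInf]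
  simp

lemma mem_coxOpen {x : 𝔸(FacetNormal A; baseScheme)} :
    x ∈ coxOpen A ↔ ∃ p : polytope A, ∀ F : FacetNormal A, realFunctional F.1 ∉ normalCone A p →
      x ∈ (𝔸(FacetNormal A; baseScheme)).basicOpen (AffineSpace.coord baseScheme F) := by
  simp only [coxOpen, TopologicalSpace.Opens.mem_iSup, mem_iInf_opens, Subtype.forall]

omit [Module.Free ℤ M] [Module.Finite ℤ M] in
lemma mem_fullSections {x : linearSystem A} :
    x ∈ fullSections A ↔ ∀ a : A, IsVertex A a.1 →
      x ∈ (linearSystem A).basicOpen (AffineSpace.coord baseScheme a) := by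
  simp only [fullSections, mem_iInf_opens, Subtype.forall]

omit [Module.Free ℤ M] [Module.Finite ℤ M] in
lemma coxScheme_hom_ext {Y : Over baseScheme} {f g : Y ⟶ coxScheme A}
    (h : ∀ F, pull f (coxCoord A F) = pull g (coxCoord A F)) : f = g :=
  openSubscheme_hom_ext h

lemma exists_hom_coxScheme {Y : Over baseScheme} (v : FacetNormal A → Γ(Y.left, ⊤))
    (hv : ∀ y : Y.left, ∃ p : polytope A, ∀ F : FacetNormal A,
      realFunctional F.1 ∉ normalCone A p → y ∈ Y.left.basicOpen (v F)) :
    ∃ f : Y ⟶ coxScheme A, ∀ F, pull f (coxCoord A F) = v F :=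
  exists_hom_openSubscheme v fun y => by
    simpa only [mem_coxOpen, homOfVector_mem_basicOpen] using hv y

lemma exists_mem_basicOpen_coxCoord {Y : Over baseScheme} (f : Y ⟶ coxScheme A) (y : Y.left) :
    ∃ p : polytope A, ∀ F : FacetNormal A, realFunctional F.1 ∉ normalCone A p →
      y ∈ Y.left.basicOpen (pull f (coxCoord A F)) := by
  have h : (coxOpen A).ι (f.left y) ∈ coxOpen A := (f.left y).2
  rw [mem_coxOpen] at h
  obtain ⟨p, hp⟩ := h
  refine ⟨p, fun F hF => ?_⟩
  rw [mem_basicOpen_pull]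
  exact (openSubscheme_mem_basicOpen F _).2 (hp F hF)

lemma pull_toricSection {Y : Over baseScheme} (f : Y ⟶ coxScheme A) (a : M) :
    letI := Fintype.ofFinite (FacetNormal A)
    pull f (toricSection A a) = ∏ F, pull f (coxCoord A F) ^ facetDistance A F a := by
  simp [toricSection]

end Cox

/-! ### The coordinates of G_Q are characters; G_Q is a flat cover of the base. -/

section ToricGroup

variable {M : Type} [AddCommGroup M] {A : Finset M}

open MonObj

lemma appTop_SpecMap {R S : CommRingCat.{0}} (φ : R ⟶ S) (r : R) :
    (Spec.map φ).appTop.hom ((Scheme.ΓSpecIso R).inv.hom r) =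
      (Scheme.ΓSpecIso S).inv.hom (φ.hom r) :=
  congr(($(Scheme.ΓSpecIso_inv_naturality φ)).hom r).symm

lemma pull_one_groupCoord {Y : Over baseScheme} (F : FacetNormal A) :
    pull (1 : Y ⟶ toricGroup A) (groupCoord A F) = 1 := by
  have h : pull η[toricGroup A] (groupCoord A F) = 1 := by
    have := one_spec_asOver_spec_left (R := .of ℂ)
      (A := .of (MonoidAlgebra ℂ (Multiplicative (DivClassGroup A))))
    rw [pull, this, groupCoord]
    refine (appTop_SpecMap _ _).trans ?_
    simp
  rw [Hom.one_def, pull_comp, h, map_one]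

/-- The coordinate comes from a group element of the group algebra, which is group-like for the
comultiplication. -/
lemma pull_mul_groupCoord {Y : Over baseScheme} (g h : Y ⟶ toricGroup A) (F : FacetNormal A) :
    pull (g * h) (groupCoord A F) = pull g (groupCoord A F) * pull h (groupCoord A F) := by
  have key : pull μ[toricGroup A] (groupCoord A F) =
      pull (fst _ _) (groupCoord A F) * pull (snd _ _) (groupCoord A F) := by
    set H : CommRingCat := .of (MonoidAlgebra ℂ (Multiplicative (DivClassGroup A)))
    have h1 := mul_spec_asOver_spec_left (R := .of ℂ) (A := H)
    have h2 := pullbackSpecIso_hom_fst ℂ H H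
    have h3 := pullbackSpecIso_hom_snd ℂ H H
    have h4 : (fst (toricGroup A) (toricGroup A)).left =
        (pullbackSpecIso ℂ H H).hom ≫ _ := h2.symm
    have h5 : (snd (toricGroup A) (toricGroup A)).left =
        (pullbackSpecIso ℂ H H).hom ≫ _ := h3.symm
    have aux : ∀ (φ : H ⟶ .of (H ⊗[ℂ] H)) (x : H),
        ((pullbackSpecIso ℂ H H).hom ≫ Spec.map φ).appTop.hom
          ((Scheme.ΓSpecIso H).inv.hom x) =
        (pullbackSpecIso ℂ H H).hom.appTop.hom
          ((Scheme.ΓSpecIso (.of (H ⊗[ℂ] H))).inv.hom (φ.hom x)) := by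
      intro φ x
      rw [← appTop_SpecMap, Scheme.Hom.comp_appTop]
      rfl
    rw [pull, pull, pull, h1, h4, h5, groupCoord]
    refine (aux _ _).trans ?_
    refine Eq.trans ?_ (congrArg₂ (· * ·) (aux _ _) (aux _ _)).symm
    rw [← map_mul, ← map_mul]
    congr 2
    simp [H]
  rw [Hom.mul_def, pull_comp, key, map_mul, ← pull_comp, ← pull_comp, lift_fst, lift_snd]

lemma isUnit_groupCoord (F : FacetNormal A) : IsUnit (groupCoord A F) := by
  refine IsUnit.map _ (IsUnit.map (MonoidAlgebra.of ℂ (Multiplicative (DivClassGroup A))) ?_)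
  exact Group.isUnit _

instance : Flat (toricGroup A).hom := by
  refine Flat.SpecMap_iff.2 ?_
  rw [CommRingCat.hom_ofHom, RingHom.flat_algebraMap_iff]
  infer_instance
instance : Surjective (toricGroup A).hom :=
  have : Nonempty (toricGroup A).left :=
    inferInstanceAs (Nonempty (PrimeSpectrum
      (MonoidAlgebra ℂ (Multiplicative (DivClassGroup A)))))
  ⟨Function.surjective_to_subsingleton (α := (toricGroup A).left) (β := baseScheme) _⟩
instance [Module.Free ℤ M] [Module.Finite ℤ M] : LocallyOfFinitePresentation (toricGroup A).hom := by
  refine (HasRingHomProperty.Spec_iff (P := @LocallyOfFinitePresentation)).2 ?_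
  rw [CommRingCat.hom_ofHom, RingHom.finitePresentation_algebraMap,
    ← Algebra.FinitePresentation.of_finiteType]
  infer_instance

end ToricGroup

/-! ### The action of G_Q on U_Q and the objects with trivial bundle. -/

section TrivialBundle

open MonObj

variable {M : Type} [AddCommGroup M] {A : Finset M}

lemma cast_facetDistance (F : FacetNormal A) {a : M} (ha : a ∈ A) :
    (facetDistance A F a : ℤ) = F.1 a - ⨅ b : A, F.1 b := by
  rw [facetDistance, Int.toNat_of_nonneg]
  rw [sub_nonneg]
  exact ciInf_le (Set.finite_range _).bddBelow (⟨a, ha⟩ : A)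

/-- The product of coordinates of `G_Q` by which `G_Q` scales every section of `𝒪_Q(1)`. -/
lemma prod_groupCoord_eq [Fintype (FacetNormal A)] {a b : M} (ha : a ∈ A) (hb : b ∈ A) :
    ∏ F, groupCoord A F ^ facetDistance A F a = ∏ F, groupCoord A F ^ facetDistance A F b := by
  classical
  have key : ∀ d : FacetNormal A → ℕ, ∏ F, groupCoord A F ^ d F =
      (Scheme.ΓSpecIso _).inv.hom (MonoidAlgebra.of ℂ (Multiplicative (DivClassGroup A))
        (.ofAdd (QuotientAddGroup.mk fun F => (d F : ℤ)))) := by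
    intro d
    have h : (fun F => (d F : ℤ)) = ∑ F, d F • (Pi.single F 1 : FacetNormal A → ℤ) := by
      ext F
      simp [Finset.sum_apply, Pi.single_apply]
    have h2 : (QuotientAddGroup.mk (fun F => (d F : ℤ)) : DivClassGroup A) =
        ∑ F, d F • (QuotientAddGroup.mk (Pi.single F 1) : DivClassGroup A) := by
      rw [h]
      exact (map_sum (QuotientAddGroup.mk' (divMap A).range) _ _).trans (by simp)
    rw [h2, ofAdd_sum, map_prod, map_prod]
    refine Finset.prod_congr rfl fun F _ => ?_
    rw [ofAdd_nsmul, map_pow, map_pow, groupCoord]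
    congr!
  rw [key, key]
  congr 3
  rw [QuotientAddGroup.eq]
  -- The minima of the facet normals cancel in the difference of the two distance vectors, which is
  -- therefore the image of `b - a` under `divMap` and dies in the class group.
  refine ⟨b - a, ?_⟩
  ext F
  simp [divMap, cast_facetDistance F ha, cast_facetDistance F hb]

variable [Module.Free ℤ M] [Module.Finite ℤ M]

/-- Scaling by units does not change which coordinates vanish, so the open condition defining U_Q
holds with the same point of the polytope. -/
lemma exists_coxAct (A : Finset M) : ∃ f : toricGroup A ⊗ coxScheme A ⟶ coxScheme A,
    ∀ F, pull f (coxCoord A F) =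
      pull (fst _ _) (groupCoord A F) * pull (snd _ _) (coxCoord A F) := by
  refine exists_hom_coxScheme _ fun y => ?_
  obtain ⟨p, hp⟩ := exists_mem_basicOpen_coxCoord (snd (toricGroup A) (coxScheme A)) y
  refine ⟨p, fun F hF => ?_⟩
  rw [Scheme.basicOpen_mul, Scheme.basicOpen_of_isUnit _ ((isUnit_groupCoord F).map _)]
  exact ⟨trivial, hp F hF⟩

/-- The action of `G_Q` on `U_Q` by scaling the coordinates. -/
def coxAct (A : Finset M) : toricGroup A ⊗ coxScheme A ⟶ coxScheme A := (exists_coxAct A).choose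

lemma pull_lift_coxAct {Y : Over baseScheme} (g : Y ⟶ toricGroup A) (x : Y ⟶ coxScheme A)
    (F : FacetNormal A) : pull (lift g x ≫ coxAct A) (coxCoord A F) =
      pull g (groupCoord A F) * pull x (coxCoord A F) := by
  rw [pull_comp, coxAct, (exists_coxAct A).choose_spec, map_mul, ← pull_comp, ← pull_comp,
    lift_fst, lift_snd]

lemma lift_one_coxAct {Y : Over baseScheme} (x : Y ⟶ coxScheme A) :
    lift 1 x ≫ coxAct A = x :=
  coxScheme_hom_ext fun F => by rw [pull_lift_coxAct, pull_one_groupCoord, _root_.one_mul]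

namespace ToricStack

lemma lift_actionMap_toCox (X : ToricStack A) {Y : Over baseScheme} (g : Y ⟶ toricGroup A)
    (p : Y ⟶ X.total) :
    lift g p ≫ actionMap (toricGroup A) X.total ≫ X.toCox = lift g (p ≫ X.toCox) ≫ coxAct A :=
  coxScheme_hom_ext fun F => by
    rw [pull_lift_coxAct, pull_comp, pull_comp, X.equivariant, map_mul, ← pull_comp, ← pull_comp,
      ← pull_comp, Category.assoc, lift_fst, lift_snd_assoc]

omit [Module.Free ℤ M] [Module.Finite ℤ M] in
lemma Hom.lift_actionMap_total {X X' : ToricStack A} (f : X ⟶ X') {Y : Over baseScheme}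
    (g : Y ⟶ toricGroup A) (p : Y ⟶ X.total) :
    lift g p ≫ actionMap (toricGroup A) X.total ≫ Hom.total f =
      lift g (p ≫ Hom.total f) ≫ actionMap (toricGroup A) X'.total := by
  rw [Hom.smul_total, lift_whiskerLeft_assoc]

omit [Module.Free ℤ M] [Module.Finite ℤ M] in
lemma lift_actionMap_proj (X : ToricStack A) {Y : Over baseScheme} (g : Y ⟶ toricGroup A)
    (p : Y ⟶ X.total) :
    lift g p ≫ actionMap (toricGroup A) X.total ≫ X.proj = p ≫ X.proj := by
  rw [X.isPrincipalBundle.isPullback.w, lift_snd_assoc]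

/-- The object of `𝒳_Q` over `T` with the trivial bundle given by a morphism `T ⟶ U_Q`. -/
def ofHom {T : Over baseScheme} (x : T ⟶ coxScheme A) : ToricStack A :=
  { base := T
    total := toricGroup A ⊗ T
    action := trivialAction (toricGroup A) T
    proj := snd _ _
    isPrincipalBundle := isPrincipalBundle_snd T
    toCox := toricGroup A ◁ x ≫ coxAct A
    equivariant := fun F => by
      let := trivialAction (toricGroup A) T
      have h := actionMap_trivialAction (G := toricGroup A) T
      have h2 : toricGroup A ◁ x = lift (fst _ _) (snd _ _ ≫ x) := by ext1 <;> simp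
      rw [← pull_comp, ← pull_comp, h, lift_whiskerLeft_assoc, pull_lift_coxAct,
        pull_mul_groupCoord, h2, comp_lift_assoc, pull_lift_coxAct]
      simp only [_root_.mul_assoc, Category.assoc] }

end ToricStack

variable {J : Set (FacetNormal A)} {U : (linearSystem A).Opens}

variable (J) in
/-- The pair of a point `x` of `U_Q` and a section `s` satisfies the equations of the
incidence stack. -/
structure IsIncident {Y : Over baseScheme} (x : Y ⟶ coxScheme A) (s : Y ⟶ openScheme U) :
    Prop where
  hypersurface : ∑ a : A, pull s (coeff U a) * pull x (toricSection A a.1) = 0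
  divisor : ∀ F ∈ J, pull x (coxCoord A F) = 0

namespace IsIncident

variable {Y : Over baseScheme} {x : Y ⟶ coxScheme A} {s : Y ⟶ openScheme U}

lemma comp (h : IsIncident J x s) {Z : Over baseScheme} (f : Z ⟶ Y) :
    IsIncident J (f ≫ x) (f ≫ s) where
  hypersurface := by
    simpa only [pull_comp, map_sum, map_mul, map_zero] using congrArg (pull f) h.hypersurface
  divisor F hF := by rw [pull_comp, h.divisor F hF, map_zero]

/-- All s_a are scaled by the same character (`prod_groupCoord_eq`), so the equation is multiplied
by one common factor. -/
lemma act (h : IsIncident J x s) (g : Y ⟶ toricGroup A) :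
    IsIncident J (lift g x ≫ coxAct A) s where
  hypersurface := by
    let := Fintype.ofFinite (FacetNormal A)
    rcases A.eq_empty_or_nonempty with rfl | ⟨b, hb⟩
    · simp
    · have : ∀ a : A, pull (lift g x ≫ coxAct A) (toricSection A a.1) =
          pull g (∏ F, groupCoord A F ^ facetDistance A F b) * pull x (toricSection A a.1) := by
        intro a
        rw [← prod_groupCoord_eq a.2 hb, pull_toricSection, pull_toricSection, map_prod,
          ← Finset.prod_mul_distrib]
        refine Finset.prod_congr rfl fun F _ => ?_
        rw [pull_lift_coxAct, map_pow, mul_pow]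
      refine Eq.trans ?_ (congrArg (pull g (∏ F, groupCoord A F ^ facetDistance A F b) * ·)
        h.hypersurface |>.trans (mul_zero _))
      rw [Finset.mul_sum]
      exact Finset.sum_congr rfl fun a _ => by rw [this, mul_left_comm]
  divisor F hF := by rw [pull_lift_coxAct, h.divisor F hF, mul_zero]

end IsIncident

namespace IncidenceStack

lemma isIncident_whiskerLeft_coxAct {T : Over baseScheme} {x : T ⟶ coxScheme A}
    {s : T ⟶ openScheme U} (h : IsIncident J x s) :
    IsIncident J (toricGroup A ◁ x ≫ coxAct A) (snd (toricGroup A) T ≫ s) := by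
  have h2 : toricGroup A ◁ x = lift (fst _ _) (snd _ _ ≫ x) := by ext1 <;> simp
  rw [h2]
  exact (h.comp _).act _

/-- The object of the incidence stack over `T` with the trivial bundle given by a point of `U_Q`
and a section over `T`. -/
def ofHom {T : Over baseScheme} {x : T ⟶ coxScheme A} {s : T ⟶ openScheme U}
    (h : IsIncident J x s) : IncidenceStack A J U where
  point := ToricStack.ofHom x
  sec := s
  mem_hypersurface := (isIncident_whiskerLeft_coxAct h).hypersurface
  mem_divisor := (isIncident_whiskerLeft_coxAct h).divisor

lemma isIncident (X : IncidenceStack A J U) : IsIncident J X.point.toCox (X.point.proj ≫ X.sec) :=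
  ⟨X.mem_hypersurface, X.mem_divisor⟩

end IncidenceStack

end TrivialBundle

/-! ### Products in the incidence stack and the atlas criterion. -/

section Atlas

open MonObj Limits

variable {M : Type} [AddCommGroup M] {A : Finset M} [Module.Free ℤ M] [Module.Finite ℤ M]
variable {J : Set (FacetNormal A)} {U : (linearSystem A).Opens}

/-- A trivialization of the principal bundle of an object of `𝒳_Q`. -/
structure Trivialization (X : ToricStack A) where
  point : X.base ⟶ coxScheme A
  coord : X.total ⟶ toricGroup A
  ofPair : toricGroup A ⊗ X.base ⟶ X.total
  ofPair_coord : ofPair ≫ coord = fst _ _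
  ofPair_proj : ofPair ≫ X.proj = snd _ _
  lift_ofPair : lift coord X.proj ≫ ofPair = 𝟙 _
  smul_coord : actionMap (toricGroup A) X.total ≫ coord = fst _ _ * (snd _ _ ≫ coord)
  toCox_eq : lift coord (X.proj ≫ point) ≫ coxAct A = X.toCox

attribute [simp] Trivialization.ofPair_coord Trivialization.ofPair_proj Trivialization.lift_ofPair

/-- The trivialization of a trivial bundle. -/
def ToricStack.trivialization {T : Over baseScheme} (x : T ⟶ coxScheme A) :
    Trivialization (ToricStack.ofHom x) where
  point := x
  coord := fst (toricGroup A) T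
  ofPair := 𝟙 (toricGroup A ⊗ T)
  ofPair_coord := Category.id_comp _
  ofPair_proj := Category.id_comp _
  lift_ofPair := (Category.comp_id _).trans lift_fst_snd
  smul_coord := by
    let := trivialAction (toricGroup A) T
    exact (congrArg (· ≫ fst (toricGroup A) T) (actionMap_trivialAction T)).trans (lift_fst _ _)
  toCox_eq := by
    refine congrArg (· ≫ coxAct A) ?_
    ext1
    · exact (lift_fst _ _).trans (whiskerLeft_fst _ _).symm
    · exact (lift_snd _ _).trans (whiskerLeft_snd _ _).symm

namespace Trivialization

variable {X : ToricStack A} (τ : Trivialization X) {Y : Over baseScheme}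

@[simp]
lemma ofPair_proj_assoc (f : X.base ⟶ Y) : τ.ofPair ≫ X.proj ≫ f = snd _ _ ≫ f := by
  rw [← Category.assoc, τ.ofPair_proj]

lemma hom_ext {p q : Y ⟶ X.total} (h1 : p ≫ τ.coord = q ≫ τ.coord)
    (h2 : p ≫ X.proj = q ≫ X.proj) : p = q := by
  rw [← Category.comp_id p, ← Category.comp_id q, ← τ.lift_ofPair, comp_lift_assoc, comp_lift_assoc,
    h1, h2]

lemma lift_actionMap_coord (g : Y ⟶ toricGroup A) (p : Y ⟶ X.total) :
    lift g p ≫ actionMap (toricGroup A) X.total ≫ τ.coord = g * (p ≫ τ.coord) := by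
  rw [τ.smul_coord, MonObj.comp_mul, lift_fst, lift_snd_assoc]

lemma comp_toCox (p : Y ⟶ X.total) :
    p ≫ X.toCox = lift (p ≫ τ.coord) (p ≫ X.proj ≫ τ.point) ≫ coxAct A := by
  rw [← τ.toCox_eq, comp_lift_assoc]

/-- The unit section of a trivial bundle. -/
def unitSection : X.base ⟶ X.total := lift 1 (𝟙 _) ≫ τ.ofPair

@[simp]
lemma unitSection_coord : τ.unitSection ≫ τ.coord = 1 := by
  simp [unitSection]

@[simp]
lemma unitSection_proj : τ.unitSection ≫ X.proj = 𝟙 _ := by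
  simp [unitSection]

@[simp]
lemma unitSection_proj_assoc (f : X.base ⟶ Y) : τ.unitSection ≫ X.proj ≫ f = f := by
  rw [← Category.assoc, unitSection_proj, Category.id_comp]

lemma lift_unitSection_actionMap :
    lift τ.coord (X.proj ≫ τ.unitSection) ≫ actionMap (toricGroup A) X.total = 𝟙 _ := by
  apply τ.hom_ext
  · rw [Category.assoc, lift_actionMap_coord, Category.assoc, unitSection_coord, MonObj.comp_one,
      _root_.mul_one, Category.id_comp]
  · rw [Category.assoc, ToricStack.lift_actionMap_proj, Category.assoc, unitSection_proj,
      Category.comp_id, Category.id_comp]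

lemma unitSection_toCox : τ.unitSection ≫ X.toCox = τ.point := by
  rw [comp_toCox, unitSection_coord, unitSection_proj_assoc, lift_one_coxAct]

/-- The arrow from a trivial bundle given by a morphism from the base. -/
def homOfSection {X' : ToricStack A} (q : X.base ⟶ X'.total) (hq : q ≫ X'.toCox = τ.point) :
    X ⟶ X' where
  base := q ≫ X'.proj
  total := lift τ.coord (X.proj ≫ q) ≫ actionMap (toricGroup A) X'.total
  smul_total := by
    have h1 : toricGroup A ◁ (lift τ.coord (X.proj ≫ q) ≫ actionMap (toricGroup A) X'.total) =
        lift (fst _ _) (lift (snd _ _ ≫ τ.coord) (snd _ _ ≫ X.proj ≫ q) ≫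
          actionMap (toricGroup A) X'.total) := by
      ext1
      · simp
      · simp [comp_lift_assoc]
    rw [h1, lift_actionMap_assoc, comp_lift_assoc, τ.smul_coord,
      X.isPrincipalBundle.isPullback.w_assoc]
  isPullback := by
    have hw := X'.isPrincipalBundle.isPullback
    -- The group coordinate of the lift is the unique element that carries `c.snd ≫ q` to `c.fst`;
    -- it exists because the bundle of `X'` is a torsor.
    refine ⟨⟨?_⟩, ⟨PullbackCone.IsLimit.mk _
      (fun c => lift (hw.lift c.fst (c.snd ≫ q) (by simp [c.condition]) ≫ fst _ _) c.snd ≫ τ.ofPair)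
      ?_ ?_ ?_⟩⟩
    · rw [Category.assoc, X'.lift_actionMap_proj, Category.assoc]
    · intro c
      have h0 : c.fst ≫ X'.proj = (c.snd ≫ q) ≫ X'.proj := by simp [c.condition]
      have h1 := hw.lift_fst c.fst (c.snd ≫ q) h0
      have h2 := hw.lift_snd c.fst (c.snd ≫ q) h0
      generalize hw.lift c.fst (c.snd ≫ q) h0 = l at h1 h2
      have h3 : (lift (l ≫ fst _ _) c.snd ≫ τ.ofPair) ≫ lift τ.coord (X.proj ≫ q) = l := by
        ext1
        · simp
        · simp [← h2]
      rw [← Category.assoc, h3, h1]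
    · intro c
      simp
    · intro c m h1 h2
      apply τ.hom_ext
      · rw [Category.assoc, ofPair_coord, lift_fst]
        have : hw.lift c.fst (c.snd ≫ q) (by simp [c.condition]) =
            m ≫ lift τ.coord (X.proj ≫ q) := by
          apply hw.hom_ext
          · rw [hw.lift_fst, Category.assoc, h1]
          · rw [hw.lift_snd, Category.assoc, lift_snd, ← h2, Category.assoc]
        rw [this, Category.assoc, lift_fst]
      · rw [Category.assoc, ofPair_proj, lift_snd, h2]
  total_toCox := by
    rw [Category.assoc, X'.lift_actionMap_toCox, Category.assoc, hq, τ.toCox_eq]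

lemma unitSection_homOfSection {X' : ToricStack A} (q : X.base ⟶ X'.total)
    (hq : q ≫ X'.toCox = τ.point) : τ.unitSection ≫ (τ.homOfSection q hq).total = q := by
  rw [homOfSection, comp_lift_assoc, unitSection_coord, unitSection_proj_assoc,
    lift_one_actionMap]

/-- Every point of a trivial bundle is a translate of the unit section, so an equivariant map is
determined there. -/
lemma hom_eq_of_unitSection {X' : ToricStack A} {f g : X ⟶ X'}
    (h : τ.unitSection ≫ f.total = τ.unitSection ≫ g.total) : f = g := by
  have hb : ∀ f : X ⟶ X', f.base = (τ.unitSection ≫ f.total) ≫ X'.proj := fun f => by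
    rw [Category.assoc, f.isPullback.w, unitSection_proj_assoc]
  have ht : ∀ f : X ⟶ X', f.total =
      lift τ.coord (X.proj ≫ τ.unitSection ≫ f.total) ≫ actionMap (toricGroup A) X'.total := by
    intro f
    have := congrArg (· ≫ f.total) τ.lift_unitSection_actionMap
    simp only [Category.assoc, Category.id_comp, ToricStack.Hom.lift_actionMap_total] at this
    exact this.symm
  apply ToricStack.Hom.ext
  · rw [hb f, hb g, h]
  · rw [ht f, ht g, h]

/-- The trivialization induced by an arrow to a trivial bundle. -/
def pullback {Z : ToricStack A} (α : Z ⟶ X) : Trivialization Z where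
  point := α.base ≫ τ.point
  coord := α.total ≫ τ.coord
  ofPair := α.isPullback.lift (lift (fst _ _) (snd _ _ ≫ α.base) ≫ τ.ofPair) (snd _ _) (by simp)
  ofPair_coord := by rw [α.isPullback.lift_fst_assoc]; simp
  ofPair_proj := α.isPullback.lift_snd _ _ _
  lift_ofPair := by
    apply α.isPullback.hom_ext
    · rw [Category.assoc, α.isPullback.lift_fst, comp_lift_assoc, lift_fst, lift_snd_assoc,
        Category.id_comp, ← α.isPullback.w, ← comp_lift_assoc, τ.lift_ofPair, Category.comp_id]
    · rw [Category.assoc, α.isPullback.lift_snd, lift_snd, Category.id_comp]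
  smul_coord := by
    rw [← Category.assoc, α.smul_total, Category.assoc, τ.smul_coord, MonObj.comp_mul]
    simp
  toCox_eq := by
    rw [← α.total_toCox, τ.comp_toCox, ← α.isPullback.w_assoc]

lemma unitSection_pullback {Z : ToricStack A} (α : Z ⟶ X) :
    (τ.pullback α).unitSection ≫ α.total = lift 1 α.base ≫ τ.ofPair := by
  apply τ.hom_ext
  · have := (τ.pullback α).unitSection_coord
    simp only [pullback] at this
    rw [Category.assoc, Category.assoc, ofPair_coord, lift_fst]
    exact this
  · have := (τ.pullback α).unitSection_proj
    rw [Category.assoc, Category.assoc, ofPair_proj, lift_snd, α.isPullback.w, ← Category.assoc, this,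
      Category.id_comp]

end Trivialization

namespace IncidenceStack

lemma hom_ext {X Y : IncidenceStack A J U} {f g : X ⟶ Y} (h : f.point = g.point) : f = g :=
  Hom.ext h

/-- The arrow from a trivial bundle given by a morphism from the base. -/
def homOfSection {X X' : IncidenceStack A J U} (τ : Trivialization X.point)
    (q : X.point.base ⟶ X'.point.total) (hq : q ≫ X'.point.toCox = τ.point)
    (hs : q ≫ X'.point.proj ≫ X'.sec = X.sec) : X ⟶ X' where
  point := τ.homOfSection q hq
  base_sec := (Category.assoc _ _ _).trans hs

lemma comp_point {X Y Z : IncidenceStack A J U} (f : X ⟶ Y) (g : Y ⟶ Z) :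
    (f ≫ g).point = f.point ≫ g.point := rfl

omit [Module.Free ℤ M] [Module.Finite ℤ M] in
lemma _root_.ToricIncidence.ToricStack.comp_total {X Y Z : ToricStack A} (f : X ⟶ Y) (g : Y ⟶ Z) :
    (f ≫ g).total = f.total ≫ g.total := rfl

variable {X E P : IncidenceStack A J U}

/-- The product of a trivial bundle with a classifying base and any object `E` is the trivial
bundle on the total space of `E`. -/
lemma exists_binaryFan (τ : Trivialization X.point)
    (huniq : ∀ (Y : Over baseScheme) (f f' : Y ⟶ X.point.base), f ≫ τ.point = f' ≫ τ.point →
      f ≫ X.sec = f' ≫ X.sec → f = f')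
    (τP : Trivialization P.point) (b : P.point.base ≅ E.point.total)
    (hbx : b.hom ≫ E.point.toCox = τP.point)
    (hbs : b.hom ≫ E.point.proj ≫ E.sec = P.sec)
    (f : P.point.base ⟶ X.point.base) (hfx : f ≫ τ.point = τP.point)
    (hfs : f ≫ X.sec = P.sec) :
    ∃ (p₁ : P ⟶ X) (p₂ : P ⟶ E), p₂.point.base = b.hom ≫ E.point.proj ∧
      Nonempty (IsLimit (BinaryFan.mk p₁ p₂)) := by
  have hq : (lift 1 f ≫ τ.ofPair) ≫ X.point.toCox = τP.point := by
    rw [τ.comp_toCox, Category.assoc, τ.ofPair_coord, lift_fst, Category.assoc,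
      τ.ofPair_proj_assoc, lift_snd_assoc, hfx, lift_one_coxAct]
  let p₁ : P ⟶ X := homOfSection τP (lift 1 f ≫ τ.ofPair) hq (by simpa using hfs)
  let p₂ : P ⟶ E := homOfSection τP b.hom hbx hbs
  have hp₁ : p₁.point.total ≫ τ.coord = τP.coord := by
    change (lift τP.coord _ ≫ actionMap _ _) ≫ _ = _
    rw [Category.assoc, τ.lift_actionMap_coord]
    simp
  have hp₁b : p₁.point.base = f := by
    change (lift 1 f ≫ τ.ofPair) ≫ _ = _
    rw [Category.assoc, τ.ofPair_proj, lift_snd]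
  have hp₂ : ∀ {Y : Over baseScheme} (q : Y ⟶ P.point.total), q ≫ p₂.point.total =
      lift (q ≫ τP.coord) (q ≫ P.point.proj ≫ b.hom) ≫ actionMap _ _ := by
    intro Y q
    change q ≫ lift τP.coord _ ≫ actionMap _ _ = _
    rw [comp_lift_assoc]
  -- An arrow `α` trivializes the bundle of `Z`, and `β` carries the resulting unit section to the
  -- total space of `E`. Since the base of `X` classifies, `huniq` forces the induced map to it to
  -- be that of `α`.
  have hcls : ∀ {Z : IncidenceStack A J U} (α : Z ⟶ X) (β : Z ⟶ E),
      ((τ.pullback α.point).unitSection ≫ β.point.total) ≫ b.inv ≫ f = α.point.base := by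
    intro Z α β
    apply huniq
    · rw [Category.assoc, Category.assoc, Category.assoc, hfx, ← hbx, b.inv_hom_id_assoc,
        β.point.total_toCox, Trivialization.unitSection_toCox]
      rfl
    · rw [Category.assoc, Category.assoc, Category.assoc, hfs, ← hbs, b.inv_hom_id_assoc,
        β.point.isPullback.w_assoc, β.base_sec, Trivialization.unitSection_proj_assoc, α.base_sec]
  have hlift : ∀ (Z : IncidenceStack A J U) (α : Z ⟶ X) (β : Z ⟶ E),
      ∃ φ : Z ⟶ P, φ ≫ p₁ = α ∧ φ ≫ p₂ = β := by
    intro Z α β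
    -- The base of `P` is the total space of `E`, so `q`, transported by `b`, is the base map of the
    -- required arrow.
    set q := (τ.pullback α.point).unitSection ≫ β.point.total with hq'
    have e1 : (lift 1 (q ≫ b.inv) ≫ τP.ofPair) ≫ P.point.toCox = (τ.pullback α.point).point := by
      rw [τP.comp_toCox, Category.assoc, τP.ofPair_coord, lift_fst, Category.assoc,
        τP.ofPair_proj_assoc, lift_snd_assoc, lift_one_coxAct, ← hbx, Category.assoc,
        b.inv_hom_id_assoc, hq', Category.assoc, β.point.total_toCox,
        Trivialization.unitSection_toCox]
    have e2 : (lift 1 (q ≫ b.inv) ≫ τP.ofPair) ≫ P.point.proj ≫ P.sec = Z.sec := by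
      rw [Category.assoc, τP.ofPair_proj_assoc, lift_snd_assoc, ← hbs, Category.assoc,
        b.inv_hom_id_assoc, hq', Category.assoc, β.point.isPullback.w_assoc, β.base_sec,
        Trivialization.unitSection_proj_assoc]
    refine ⟨homOfSection (τ.pullback α.point) (lift 1 (q ≫ b.inv) ≫ τP.ofPair) e1 e2, ?_, ?_⟩
    · apply IncidenceStack.hom_ext
      apply (τ.pullback α.point).hom_eq_of_unitSection
      rw [comp_point, ToricStack.comp_total, Trivialization.unitSection_pullback, ← Category.assoc]
      have h1 := (τ.pullback α.point).unitSection_homOfSection _ e1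
      refine (congrArg (· ≫ p₁.point.total) h1).trans ?_
      apply τ.hom_ext
      · rw [Category.assoc, hp₁, Category.assoc, τP.ofPair_coord, lift_fst, Category.assoc,
          τ.ofPair_coord, lift_fst]
      · rw [Category.assoc, p₁.point.isPullback.w, Category.assoc, τP.ofPair_proj_assoc,
          lift_snd_assoc, hp₁b, Category.assoc, hcls, Category.assoc, τ.ofPair_proj, lift_snd]
    · apply IncidenceStack.hom_ext
      apply (τ.pullback α.point).hom_eq_of_unitSection
      rw [comp_point, ToricStack.comp_total, ← Category.assoc]
      have h1 := (τ.pullback α.point).unitSection_homOfSection _ e1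
      refine (congrArg (· ≫ p₂.point.total) h1).trans ?_
      rw [hp₂, Category.assoc, τP.ofPair_coord, lift_fst, Category.assoc, τP.ofPair_proj_assoc,
          lift_snd_assoc, Category.assoc, b.inv_hom_id, Category.comp_id, lift_one_actionMap]
  have huniq' : ∀ (Z : IncidenceStack A J U) (φ φ' : Z ⟶ P), φ ≫ p₁ = φ' ≫ p₁ →
      φ ≫ p₂ = φ' ≫ p₂ → φ = φ' := by
    intro Z φ φ' h1 h2
    apply IncidenceStack.hom_ext
    set τ' := τP.pullback φ.point
    -- The composite with `p₁` determines the group coordinate; the composite with `p₂` then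
    -- determines the base point.
    have hc : φ.point.total ≫ τP.coord = φ'.point.total ≫ τP.coord := by
      have := congrArg (fun k => k.point.total ≫ τ.coord) h1
      simp only [comp_point, ToricStack.comp_total, Category.assoc] at this
      simpa only [hp₁] using this
    apply τ'.hom_eq_of_unitSection
    have hu : τ'.unitSection ≫ φ.point.total ≫ τP.coord = 1 := τ'.unitSection_coord
    apply τP.hom_ext
    · rw [Category.assoc, Category.assoc, hc]
    · have := congrArg (fun k => τ'.unitSection ≫ k.point.total) h2
      simp only [comp_point, ToricStack.comp_total] at this
      rw [← Category.assoc, ← Category.assoc, hp₂, hp₂] at this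
      simp only [Category.assoc] at this ⊢
      rw [← hc, hu, lift_one_actionMap, lift_one_actionMap] at this
      simpa only [← Category.assoc, cancel_mono] using this
  choose φ hφ₁ hφ₂ using hlift
  exact ⟨p₁, p₂, rfl, ⟨BinaryFan.isLimitMk (fun c => φ c.pt c.fst c.snd) (fun c => hφ₁ _ _ _)
    (fun c => hφ₂ _ _ _)
    fun c m h1 h2 => huniq' _ _ _ (h1.trans (hφ₁ _ _ _).symm) (h2.trans (hφ₂ _ _ _).symm)⟩⟩

/-- The trivial bundle on a scheme classifying incident pairs is an atlas. -/
lemma isAtlas_ofHom {T : Over baseScheme} {x : T ⟶ coxScheme A} {s : T ⟶ openScheme U}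
    (h : IsIncident J x s)
    (hex : ∀ (Y : Over baseScheme) (x' : Y ⟶ coxScheme A) (s' : Y ⟶ openScheme U),
      IsIncident J x' s' → ∃ f : Y ⟶ T, f ≫ x = x' ∧ f ≫ s = s')
    (huniq : ∀ (Y : Over baseScheme) (f f' : Y ⟶ T), f ≫ x = f' ≫ x → f ≫ s = f' ≫ s → f = f') :
    IsAtlas (incidenceProj A J U) (ofHom h) := by
  intro E
  -- The total space of `E` carries a tautological incident pair, and `f` classifies it.
  obtain ⟨f, hfx, hfs⟩ := hex _ _ _ E.isIncident
  obtain ⟨p₁, p₂, hp, hlim⟩ := exists_binaryFan (X := ofHom h) (E := E)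
    (P := ofHom E.isIncident) (ToricStack.trivialization x) huniq
    (ToricStack.trivialization E.point.toCox) (Iso.refl _) (Category.id_comp _)
    (Category.id_comp _) f hfx hfs
  have hp' : ((incidenceProj A J U).map p₂).left = E.point.proj.left := by
    refine (congrArg (fun k => k.left) hp).trans ?_
    exact congrArg (fun k => k.left) (Category.id_comp E.point.proj)
  have := E.point.isPrincipalBundle
  refine ⟨BinaryFan.mk p₁ p₂, hlim, ?_, ?_, ?_⟩
  · exact hp'.symm ▸ this.flat
  · exact hp'.symm ▸ this.surjective
  · exact hp'.symm ▸ this.locallyOfFinitePresentation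

end IncidenceStack

end Atlas

/-! ### Vertices and facets of the polytope. -/

section Polyhedral

variable {M : Type} [AddCommGroup M]

lemma latticePoint_sub (a b : M) : latticePoint (a - b) = latticePoint a - latticePoint b :=
  TensorProduct.tmul_sub _ _ _

lemma latticePoint_mem_polytope {A : Finset M} {a : M} (ha : a ∈ A) :
    latticePoint a ∈ polytope A :=
  subset_convexHull ℝ _ ⟨a, ha, rfl⟩

/-- A point of the polytope is a convex combination of the elements of `A`. -/
lemma exists_weights {A : Finset M} {p : RealSpan M} (hp : p ∈ polytope A) :
    ∃ w : A → ℝ, (∀ b, 0 ≤ w b) ∧ ∑ b, w b = 1 ∧ ∑ b, w b • latticePoint b.1 = p := by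
  have h : (latticePoint '' (A : Set M)) = Set.range (fun b : A => latticePoint b.1) := by
    ext; simp
  rw [polytope, h, convexHull_range_eq_exists_affineCombination] at hp
  obtain ⟨s, w, hw0, hw1, hp⟩ := hp
  classical
  refine ⟨fun b => if b ∈ s then w b else 0, fun b => ?_, ?_, ?_⟩
  · dsimp only
    split_ifs with h
    exacts [hw0 _ h, le_rfl]
  · rw [Finset.sum_ite_mem, Finset.univ_inter, hw1]
  · rw [← hp, Finset.affineCombination_eq_linear_combination _ _ _ hw1]
    simp only [ite_smul, zero_smul]
    rw [Finset.sum_ite_mem, Finset.univ_inter]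

lemma realFunctional_mem_normalCone {A : Finset M} {n : Module.Dual ℤ M} {a : M}
    (ha : ∀ b ∈ A, n a ≤ n b) {p : RealSpan M} (hpa : realFunctional n p = n a) :
    realFunctional n ∈ normalCone A p := by
  intro q hq
  obtain ⟨w, hw0, hw1, rfl⟩ := exists_weights hq
  simp only [hpa, map_sum, map_smul, realFunctional_latticePoint, smul_eq_mul]
  calc (n a : ℝ) = ∑ b : A, w b * (n a : ℝ) := by rw [← Finset.sum_mul, hw1, one_mul]
    _ ≤ _ := Finset.sum_le_sum fun b _ =>
      mul_le_mul_of_nonneg_left (by exact_mod_cast ha _ b.2) (hw0 b)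

lemma normalCone_le {A : Finset M} {n : Module.Dual ℤ M} {p : RealSpan M}
    (h : realFunctional n ∈ normalCone A p) {a : M} (ha : a ∈ A) :
    realFunctional n p ≤ n a := by
  rw [← realFunctional_latticePoint]
  exact h _ (latticePoint_mem_polytope ha)

lemma mem_normalCone_latticePoint {A : Finset M} {n : Module.Dual ℤ M} {a : M} :
    realFunctional n ∈ normalCone A (latticePoint a) ↔ ∀ b ∈ A, n a ≤ n b := by
  refine ⟨fun h b hb => ?_, fun h => realFunctional_mem_normalCone h
    (realFunctional_latticePoint _ _)⟩
  have := normalCone_le h hb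
  rw [realFunctional_latticePoint] at this
  exact_mod_cast this

lemma realFunctional_eq_sum {A : Finset M} (n : Module.Dual ℤ M) (w : A → ℝ) :
    realFunctional n (∑ b, w b • latticePoint b.1) = ∑ b, w b * n b.1 := by
  simp only [map_sum, map_smul, realFunctional_latticePoint, smul_eq_mul]

variable [Module.Free ℤ M] [Module.Finite ℤ M]

omit [Module.Finite ℤ M] in
lemma latticePoint_injective : Function.Injective (latticePoint : M → RealSpan M) := by
  intro a b h
  rw [← sub_eq_zero, ← Module.forall_dual_apply_eq_zero_iff ℤ]
  intro n
  have := congrArg (realFunctional n) h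
  rw [realFunctional_latticePoint, realFunctional_latticePoint] at this
  rw [map_sub, sub_eq_zero]
  exact_mod_cast this

variable (M) in
/-- A norm on the real span of the lattice. -/
@[reducible] def realSpanNorm : NormedAddCommGroup (RealSpan M) :=
  NormedAddCommGroup.induced _ _ (Module.finBasis ℝ (RealSpan M)).equivFun
    (Module.finBasis ℝ (RealSpan M)).equivFun.injective

variable (M) in
/-- The norm on the real span of the lattice is a norm of vector spaces. -/
@[reducible] def realSpanNormedSpace :
    letI := realSpanNorm M
    NormedSpace ℝ (RealSpan M) :=
  letI := realSpanNorm M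
  NormedSpace.induced ℝ _ _ (Module.finBasis ℝ (RealSpan M)).equivFun

/-- A vertex is separated from the other points of `A` by an integral functional. -/
lemma IsVertex.exists_functional_lt {A : Finset M} {a : M} (ha : IsVertex A a) :
    ∃ n : Module.Dual ℤ M, ∀ b ∈ A, b ≠ a → n a < n b := by
  classical
  let := realSpanNorm M
  let := realSpanNormedSpace M
  set K := convexHull ℝ (latticePoint '' ((A.erase a : Finset M) : Set M)) with hK
  have haK : latticePoint a ∉ K := by
    have h := ((convex_convexHull ℝ _).mem_extremePoints_iff_mem_sdiff_convexHull_sdiff.1 ha.2).2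
    refine fun hmem => h (convexHull_mono ?_ hmem)
    rintro _ ⟨b, hb, rfl⟩
    rw [Finset.mem_coe, Finset.mem_erase] at hb
    exact ⟨latticePoint_mem_polytope hb.2, fun h => hb.1 (latticePoint_injective h)⟩
  have hcomp : IsCompact K := Set.Finite.isCompact_convexHull ℝ (Set.toFinite _)
  obtain ⟨f, u, hfa, hfb⟩ :=
    geometric_hahn_banach_point_closed (convex_convexHull ℝ _) hcomp.isClosed haK
  have hlt : ∀ b ∈ A.erase a, f (latticePoint a) < f (latticePoint b) := fun b hb =>
    hfa.trans (hfb _ (subset_convexHull ℝ _ ⟨b, hb, rfl⟩))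
  let B := Module.Free.chooseBasis ℤ M
  let val : (Module.Free.ChooseBasisIndex ℤ M → ℝ) → M → ℝ := fun v m => ∑ i, v i * (B.repr m i : ℝ)
  have hval : ∀ m, f (latticePoint m) = val (fun i => f (latticePoint (B i))) m := by
    intro m
    conv_lhs => rw [← B.sum_repr m]
    simp only [latticePoint, TensorProduct.tmul_sum, TensorProduct.tmul_smul, map_sum, val]
    refine Finset.sum_congr rfl fun i _ => ?_
    rw [← Int.cast_smul_eq_zsmul ℝ, map_smul, smul_eq_mul, mul_comm]
  -- Separation is a finite list of strict inequalities on the values at a basis, hence an open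
  -- condition. It therefore has a rational solution, and clearing denominators makes it integral.
  let O : Set (Module.Free.ChooseBasisIndex ℤ M → ℝ) := ⋂ b ∈ A.erase a, {v | val v a < val v b}
  have hO : IsOpen O := by
    refine isOpen_biInter_finset fun b _ => isOpen_lt ?_ ?_ <;>
    · simp only [val]
      fun_prop
  have hOne : O.Nonempty := ⟨fun i => f (latticePoint (B i)), by
    simp only [O, Set.mem_iInter, Set.mem_ofPred_eq, ← hval]
    exact hlt⟩
  obtain ⟨q, hq⟩ := (DenseRange.piMap fun _ : Module.Free.ChooseBasisIndex ℤ M =>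
    Rat.denseRange_cast (𝕜 := ℝ)).exists_mem_open hO hOne
  let D : ℕ := ∏ i, (q i).den
  have hD : ∀ i, ∃ k : ℤ, (k : ℚ) = D * q i := by
    intro i
    obtain ⟨e, he⟩ := Finset.dvd_prod_of_mem (fun i => (q i).den) (Finset.mem_univ i)
    refine ⟨e * (q i).num, ?_⟩
    simp only [D, he]
    push_cast
    rw [mul_assoc, mul_left_comm, mul_comm ((q i).den : ℚ), Rat.mul_den_eq_num]
  choose k hk using hD
  refine ⟨B.constr ℤ k, fun b hb hba => ?_⟩
  have h1 : ∀ m, ((B.constr ℤ k m : ℤ) : ℝ) = D * val (Pi.map (fun _ => Rat.cast) q) m := by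
    intro m
    rw [Module.Basis.constr_apply_fintype]
    simp only [val, Finset.mul_sum]
    push_cast
    refine Finset.sum_congr rfl fun i _ => ?_
    have : (k i : ℝ) = D * q i := by exact_mod_cast hk i
    simp [this]
    ring
  have h2 : val (Pi.map (fun _ => Rat.cast) q) a < val (Pi.map (fun _ => Rat.cast) q) b := by
    have := Set.mem_iInter₂.1 hq b (Finset.mem_erase.2 ⟨hba, hb⟩)
    exact this
  have hDpos : (0 : ℝ) < D := by
    have : 0 < D := Finset.prod_pos fun i _ => (q i).den_pos
    exact_mod_cast this
  have := mul_lt_mul_of_pos_left h2 hDpos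
  rw [← h1, ← h1] at this
  exact_mod_cast this

/-- Facets with a common point have a common vertex. -/
lemma exists_isVertex_of_mem_normalCone {A : Finset M} (J : Set (Module.Dual ℤ M))
    {p : RealSpan M} (hp : p ∈ polytope A) (hJ : ∀ n ∈ J, realFunctional n ∈ normalCone A p) :
    ∃ a, IsVertex A a ∧ ∀ n ∈ J, ∀ b ∈ A, n a ≤ n b := by
  let := realSpanNorm M
  let := realSpanNormedSpace M
  -- `K` is the face on which all functionals of `J` are minimal. It is compact and nonempty, so it
  -- has an extreme point, which is also extreme in the polytope.
  let K : Set (RealSpan M) := polytope A ∩ ⋂ n ∈ J, {q | realFunctional n q ≤ realFunctional n p}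
  have hcomp : IsCompact K := by
    refine (Set.Finite.isCompact_convexHull ℝ (Set.toFinite _)).inter_right ?_
    refine isClosed_biInter fun n _ => isClosed_le ?_ continuous_const
    exact LinearMap.continuous_of_finiteDimensional _
  have hmem : ∀ q, q ∈ K ↔ q ∈ polytope A ∧ ∀ n ∈ J, realFunctional n q ≤ realFunctional n p := by
    simp [K]
  obtain ⟨v, hv⟩ := hcomp.extremePoints_nonempty ⟨p, (hmem p).2 ⟨hp, fun _ _ => le_rfl⟩⟩
  have hext : IsExtreme ℝ (polytope A) K := by
    refine ⟨fun q hq => ((hmem q).1 hq).1, ?_⟩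
    intro x hx y hy z hz hzxy
    refine (hmem x).2 ⟨hx, fun n hn => ?_⟩
    obtain ⟨s, t, hs, ht, hst, rfl⟩ := hzxy
    have h1 := ((hmem _).1 hz).2 n hn
    have h2 := hJ n hn y hy
    simp only [map_add, map_smul, smul_eq_mul] at h1
    have h3 := mul_le_mul_of_nonneg_left h2 ht.le
    have h4 : t = 1 - s := by linarith
    subst h4
    nlinarith
  have hvQ := hext.extremePoints_subset_extremePoints hv
  obtain ⟨a, ha, rfl⟩ := extremePoints_convexHull_subset hvQ
  refine ⟨a, ⟨ha, hvQ⟩, fun n hn b hb => ?_⟩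
  have h1 := ((hmem _).1 (extremePoints_subset hv)).2 n hn
  have h2 := normalCone_le (hJ n hn) hb
  rw [realFunctional_latticePoint] at h1
  exact_mod_cast h1.trans h2

-- The quotient by `L` has positive rank, hence a non-torsion element, and functionals separate
-- points of the quotient modulo torsion.
omit [Module.Free ℤ M] in
lemma exists_dual_ne_zero_of_finrank_lt (L : Submodule ℤ M)
    (hL : Module.finrank ℤ L < Module.finrank ℤ M) :
    ∃ m : Module.Dual ℤ M, m ≠ 0 ∧ ∀ x ∈ L, m x = 0 := by
  let V := M ⧸ L
  have hV : Module.finrank ℤ V ≠ 0 := by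
    have := Submodule.finrank_quotient_add_finrank L
    change Module.finrank ℤ (M ⧸ L) ≠ 0
    omega
  have h2 : ∃ v : V, v ∉ Submodule.torsion ℤ V := by
    by_contra! h
    apply hV
    rw [Module.finrank_eq_zero_iff]
    intro v
    obtain ⟨r, hr⟩ := h v
    exact ⟨r.1, nonZeroDivisors.ne_zero r.2, hr⟩
  obtain ⟨v, hv⟩ := h2
  have h3 : (Submodule.torsion ℤ V).mkQ v ≠ 0 := by simpa using hv
  rw [← not_forall_not] 
  intro hcon
  refine h3 ((Module.forall_dual_apply_eq_zero_iff ℤ _).1 fun φ => ?_)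
  obtain ⟨m, rfl⟩ := L.mkQ_surjective v
  by_contra hne
  refine hcon (φ ∘ₗ (Submodule.torsion ℤ V).mkQ ∘ₗ L.mkQ) ⟨fun h => hne ?_, fun x hx => ?_⟩
  · exact congrArg (fun k => k m) h
  · have : L.mkQ x = 0 := by simpa using hx
    simp [this]

/-- By flatness of ℝ over ℤ, the real span is the base change of the integral span. -/
lemma finrank_span_latticePoint (S : Set M) :
    Module.finrank ℝ (Submodule.span ℝ (latticePoint '' S)) =
      Module.finrank ℤ (Submodule.span ℤ S) := by
  set L := Submodule.span ℤ S
  have h1 : Submodule.span ℝ (latticePoint '' S) = LinearMap.range (L.subtype.baseChange ℝ) := by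
    have := Submodule.baseChange_span (R := ℤ) ℝ S
    refine this.symm.trans ?_
    rfl
  have h2 : Function.Injective (L.subtype.baseChange ℝ) :=
    Module.Flat.lTensor_preserves_injective_linearMap (M := ℝ) L.subtype L.subtype_injective
  rw [h1, LinearMap.finrank_range_of_inj h2, Module.finrank_baseChange]

-- The supporting face is the hull of the elements of `A` where `n` is minimal, which turns its
-- dimension into a rank of lattice vectors.
omit [Module.Free ℤ M] [Module.Finite ℤ M] in
lemma vectorSpan_supportFace {A : Finset M} {n : Module.Dual ℤ M} {a : M} (ha : a ∈ A)
    (hn : ∀ b ∈ A, n a ≤ n b) : vectorSpan ℝ (supportFace A n) =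
      Submodule.span ℝ (latticePoint '' {x | ∃ b ∈ A, n b = n a ∧ x = b - a}) := by
  have htight : {b : M | b ∈ A ∧ ∀ c ∈ A, n b ≤ n c} = {b | b ∈ A ∧ n b = n a} := by
    ext b
    refine ⟨fun h => ⟨h.1, le_antisymm (h.2 a ha) (hn b h.1)⟩, fun h => ⟨h.1, fun c hc => ?_⟩⟩
    rw [h.2]
    exact hn c hc
  have h1 : vectorSpan ℝ (supportFace A n) =
      vectorSpan ℝ (latticePoint '' {b : M | b ∈ A ∧ n b = n a}) := by
    apply le_antisymm
    · rw [← htight]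
      refine (vectorSpan_mono ℝ (supportFace_subset A n)).trans ?_
      rw [← direction_affineSpan, affineSpan_convexHull, direction_affineSpan]
    · refine vectorSpan_mono ℝ ?_
      rintro _ ⟨b, ⟨hb, hba⟩, rfl⟩
      refine ⟨latticePoint_mem_polytope hb, fun q hq => ?_⟩
      exact (mem_normalCone_latticePoint (n := n) (a := b)).2
        (fun c hc => by rw [hba]; exact hn c hc) q hq
  have ha' : a ∈ {b : M | b ∈ A ∧ n b = n a} := ⟨ha, rfl⟩
  rw [h1, vectorSpan_eq_span_vsub_set_right ℝ (Set.mem_image_of_mem latticePoint ha')]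
  congr 1
  ext x
  simp only [Set.mem_image, Set.mem_ofPred_eq, vsub_eq_sub]
  constructor
  · rintro ⟨_, ⟨b, ⟨hb, hba⟩, rfl⟩, rfl⟩
    exact ⟨b - a, ⟨b, hb, hba, rfl⟩, latticePoint_sub _ _⟩
  · rintro ⟨_, ⟨b, hb, hba, rfl⟩, rfl⟩
    exact ⟨_, ⟨b, ⟨hb, hba⟩, rfl⟩, (latticePoint_sub _ _).symm⟩

omit [Module.Free ℤ M] [Module.Finite ℤ M] in
lemma span_latticePoint_sub_eq_top {A : Finset M} (hA : affineSpan ℝ (polytope A) = ⊤)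
    {a : M} (ha : a ∈ A) :
    Submodule.span ℝ (latticePoint '' {x | ∃ b ∈ A, x = b - a}) = ⊤ := by
  have h := congrArg AffineSubspace.direction hA
  rw [polytope, affineSpan_convexHull, direction_affineSpan, AffineSubspace.direction_top,
    vectorSpan_eq_span_vsub_set_right ℝ (p := latticePoint a)
      (Set.mem_image_of_mem _ ha)] at h
  rw [← h]
  congr 1
  ext x
  simp only [Set.mem_image, Set.mem_ofPred_eq, vsub_eq_sub]
  constructor
  · rintro ⟨_, ⟨b, hb, rfl⟩, rfl⟩
    exact ⟨_, ⟨b, hb, rfl⟩, (latticePoint_sub _ _).symm⟩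
  · rintro ⟨_, ⟨b, hb, rfl⟩, rfl⟩
    exact ⟨b - a, ⟨b, hb, rfl⟩, latticePoint_sub _ _⟩

-- This is how full-dimensionality is used: the differences `b - a` span the whole space.
omit [Module.Free ℤ M] [Module.Finite ℤ M] in
lemma eq_zero_of_forall_sub_eq_zero {A : Finset M} (hA : affineSpan ℝ (polytope A) = ⊤)
    {a : M} (ha : a ∈ A) {m : Module.Dual ℤ M} (hm : ∀ b ∈ A, m (b - a) = 0) : m = 0 := by
  have h : (⊤ : Submodule ℝ (RealSpan M)) ≤ LinearMap.ker (realFunctional m) := by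
    rw [← span_latticePoint_sub_eq_top hA ha, Submodule.span_le]
    rintro _ ⟨_, ⟨b, hb, rfl⟩, rfl⟩
    have := hm b hb
    simp only [SetLike.mem_coe, LinearMap.mem_ker, realFunctional_latticePoint]
    exact_mod_cast this
  ext x
  have : realFunctional m (latticePoint x) = 0 := h trivial
  rw [realFunctional_latticePoint] at this
  exact_mod_cast this

omit [Module.Free ℤ M] [Module.Finite ℤ M] in
/-- Moving a supporting functional in a direction until it meets a new element of `A`. -/
lemma exists_push {A : Finset M} {a : M} {n m : Module.Dual ℤ M}
    (hn : ∀ b ∈ A, 0 ≤ n (b - a)) (hm : ∀ b ∈ A, n (b - a) = 0 → m (b - a) = 0)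
    (hneg : ∃ b ∈ A, m (b - a) < 0) :
    ∃ s t : ℤ, 0 < s ∧ 0 < t ∧ (∀ b ∈ A, 0 ≤ (s • n + t • m) (b - a)) ∧
      ∃ b ∈ A, n (b - a) ≠ 0 ∧ (s • n + t • m) (b - a) = 0 := by
  classical
  let B := A.filter fun b => m (b - a) < 0
  have hB : B.Nonempty := by
    obtain ⟨b, hb, h⟩ := hneg
    exact ⟨b, Finset.mem_filter.2 ⟨hb, h⟩⟩
  -- The ratio is the time at which `n + time • m` vanishes on `b - a`; the point `c` is met first.
  -- Multiplying through by `-m (c - a)` keeps the functional integral.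
  obtain ⟨c, hc, hmin⟩ := B.exists_min_image (fun b => (n (b - a) : ℚ) / (-m (b - a))) hB
  obtain ⟨hcA, hcm⟩ := Finset.mem_filter.1 hc
  have hnc : n (c - a) ≠ 0 := fun h => hcm.ne (hm c hcA h)
  refine ⟨-m (c - a), n (c - a), by omega, lt_of_le_of_ne (hn c hcA) hnc.symm, fun b hb => ?_,
    c, hcA, hnc, ?_⟩
  · simp only [LinearMap.add_apply, LinearMap.smul_apply, smul_eq_mul]
    rcases lt_or_ge (m (b - a)) 0 with h | h
    · have := hmin b (Finset.mem_filter.2 ⟨hb, h⟩)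
      have h1 : (0 : ℚ) < -m (c - a) := by exact_mod_cast neg_pos.2 hcm
      have h2 : (0 : ℚ) < -m (b - a) := by exact_mod_cast neg_pos.2 h
      rw [div_le_div_iff₀ h1 h2] at this
      have h3 : n (c - a) * -m (b - a) ≤ n (b - a) * -m (c - a) := by exact_mod_cast this
      linarith
    · have h1 := mul_nonneg (neg_nonneg.2 hcm.le) (hn b hb)
      have h2 := mul_nonneg (hn c hcA) h
      linarith
  · simp only [LinearMap.add_apply, LinearMap.smul_apply, smul_eq_mul]
    ring

/-- In codimension at least two there is room to tilt the supporting hyperplane about the face. One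
of two opposite tilts keeps `p` strictly off it, and tilting until a new element of `A` is met
enlarges the face. -/
lemma exists_more_tight {A : Finset M} (hA : affineSpan ℝ (polytope A) = ⊤) {a : M} (ha : a ∈ A)
    {n : Module.Dual ℤ M} (hn : ∀ b ∈ A, 0 ≤ n (b - a)) {p : M} (hp : 0 < n (p - a))
    (hrank : Module.finrank ℝ (vectorSpan ℝ (supportFace A n)) + 1 < Module.finrank ℤ M) :
    ∃ n' : Module.Dual ℤ M, (∀ b ∈ A, 0 ≤ n' (b - a)) ∧ 0 < n' (p - a) ∧
      (∀ b ∈ A, n (b - a) = 0 → n' (b - a) = 0) ∧ ∃ b ∈ A, n (b - a) ≠ 0 ∧ n' (b - a) = 0 := by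
  rw [vectorSpan_supportFace ha (fun b hb => by simpa using hn b hb)] at hrank
  set S := {x | ∃ b ∈ A, n b = n a ∧ x = b - a}
  -- A nonzero `m` vanishing on `e` must take both signs on the differences `b - a`, so pushes along
  -- `m` and along `-m` both stop. The missing second dimension pays for this extra condition.
  let e : M := ∑ b ∈ A, (b - a)
  obtain ⟨m, hm0, hm⟩ := exists_dual_ne_zero_of_finrank_lt (Submodule.span ℤ (insert e S)) (by
    rw [← finrank_span_latticePoint, Set.image_insert_eq, Submodule.span_insert]
    have h1 := Submodule.finrank_add_le_finrank_add_finrank (ℝ ∙ latticePoint e)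
      (Submodule.span ℝ (latticePoint '' S))
    have h2 : Module.finrank ℝ (ℝ ∙ latticePoint e) ≤ 1 := by
      simpa using finrank_span_le_card ({latticePoint e} : Set (RealSpan M))
    omega)
  have hmt : ∀ b ∈ A, n (b - a) = 0 → m (b - a) = 0 := fun b hb h =>
    hm _ (Submodule.subset_span (Or.inr ⟨b, hb, by simpa [sub_eq_zero] using h, rfl⟩))
  have hme : ∑ b ∈ A, m (b - a) = 0 := by
    rw [← map_sum]
    exact hm _ (Submodule.subset_span (Or.inl rfl))
  have hne : ∃ b ∈ A, m (b - a) ≠ 0 := by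
    by_contra! h
    exact hm0 (eq_zero_of_forall_sub_eq_zero hA ha h)
  have hpos : ∃ b ∈ A, 0 < m (b - a) := by
    by_contra! h
    obtain ⟨b, hb, hb0⟩ := hne
    exact hb0 ((Finset.sum_eq_zero_iff_of_nonpos h).1 hme b hb)
  have hneg : ∃ b ∈ A, m (b - a) < 0 := by
    by_contra! h
    obtain ⟨b, hb, hb0⟩ := hne
    exact hb0 ((Finset.sum_eq_zero_iff_of_nonneg h).1 hme b hb)
  obtain ⟨s, t, hs, ht, h1, h2⟩ := exists_push hn hmt hneg
  obtain ⟨s', t', hs', ht', h1', h2'⟩ := exists_push (m := -m) hn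
    (fun b hb h => by simp [hmt b hb h])
    (by
      obtain ⟨b, hb, h⟩ := hpos
      exact ⟨b, hb, by simpa using h⟩)
  by_cases hpp : 0 < (s • n + t • m) (p - a)
  · exact ⟨_, h1, hpp, fun b hb h => by simp [h, hmt b hb h], h2⟩
  -- If the push along `m` loses positivity at `p`, then `m (p - a) < 0`, and the push along `-m`
  -- preserves it.
  · refine ⟨_, h1', ?_, fun b hb h => by simp [h, hmt b hb h], h2'⟩
    rw [not_lt] at hpp
    simp only [LinearMap.add_apply, LinearMap.smul_apply, LinearMap.neg_apply, smul_eq_mul]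
      at hpp ⊢
    have h3 : m (p - a) < 0 := by
      by_contra! h
      have := mul_pos hs hp
      have := mul_nonneg ht.le h
      linarith
    have := mul_pos hs' hp
    have := mul_pos ht' (neg_pos.2 h3)
    linarith

-- Take out the largest positive integer dividing `n`; a nonzero value `n x` bounds such divisors.
omit [Module.Free ℤ M] [Module.Finite ℤ M] in
lemma exists_eq_smul_primitive {n : Module.Dual ℤ M} (hn : n ≠ 0) :
    ∃ (k : ℤ) (n' : Module.Dual ℤ M), 0 < k ∧ n = k • n' ∧
      ∀ (j : ℤ) (n'' : Module.Dual ℤ M), n' = j • n'' → IsUnit j := by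
  classical
  obtain ⟨x, hx⟩ : ∃ x, n x ≠ 0 := by
    by_contra! h
    exact hn (LinearMap.ext h)
  let P : ℕ → Prop := fun k => ∃ n' : Module.Dual ℤ M, n = (k : ℤ) • n'
  have hbound : ∀ k, P k → k ≤ (n x).natAbs := by
    rintro k ⟨n', h⟩
    refine Nat.le_of_dvd (Int.natAbs_pos.2 hx) ?_
    rw [← Int.natCast_dvd]
    exact ⟨n' x, by rw [h]; rfl⟩
  have hP1 : P 1 := ⟨n, by simp⟩
  obtain ⟨n', hn'⟩ : P (Nat.findGreatest P (n x).natAbs) :=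
    Nat.findGreatest_spec (hbound 1 hP1) hP1
  set k := Nat.findGreatest P (n x).natAbs
  have hk : 0 < k := by
    rcases Nat.eq_zero_or_pos k with h | h
    · rw [h] at hn'
      exact absurd (by simpa using hn') hn
    · exact h
  refine ⟨k, n', by exact_mod_cast hk, hn', fun j n'' hj => ?_⟩
  have hPj : P (k * j.natAbs) := by
    rcases Int.natAbs_eq j with h | h
    · refine ⟨n'', ?_⟩
      rw [hn', hj, smul_smul]
      push_cast
      rw [Int.natCast_natAbs] at h
      conv_lhs => rw [h]
    · refine ⟨-n'', ?_⟩
      rw [hn', hj, smul_smul]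
      push_cast
      rw [Int.natCast_natAbs] at h
      conv_lhs => rw [h]
      simp
  have hle : k * j.natAbs ≤ k := Nat.le_findGreatest (hbound _ hPj) hPj
  have hj0 : j ≠ 0 := by
    rintro rfl
    rw [zero_smul] at hj
    rw [hj, smul_zero] at hn'
    exact hn hn'
  rw [Int.isUnit_iff_natAbs_eq]
  have := Int.natAbs_pos.2 hj0
  have : j.natAbs ≤ 1 := Nat.le_of_mul_le_mul_left (by simpa using hle) hk
  omega

/-- Every other element of `A` is off some facet through a given vertex. -/
lemma IsVertex.exists_facet {A : Finset M} (hA : affineSpan ℝ (polytope A) = ⊤) {a : M}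
    (ha : IsVertex A a) {p : M} (hp : p ∈ A) (hpa : p ≠ a) :
    ∃ F : FacetNormal A, (∀ b ∈ A, F.1 a ≤ F.1 b) ∧ F.1 a < F.1 p := by
  classical
  let P : Module.Dual ℤ M → Prop := fun n => (∀ b ∈ A, 0 ≤ n (b - a)) ∧ 0 < n (p - a)
  let tight : Module.Dual ℤ M → Finset M := fun n => A.filter fun b => n (b - a) = 0
  obtain ⟨n₀, hn₀⟩ := ha.exists_functional_lt
  have hP₀ : P n₀ := by
    refine ⟨fun b hb => ?_, by simpa using hn₀ p hp hpa⟩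
    by_cases h : b = a
    · simp [h]
    · simpa using (hn₀ b hb h).le
  -- Among the supporting functionals at `a` that are positive at `p`, choose one tight at the most
  -- elements of `A`. By `exists_more_tight` its face has codimension one.
  obtain ⟨n, hn, hmin⟩ := (measure fun n => A.card - (tight n).card).wf.has_min {n | P n} ⟨n₀, hP₀⟩
  have hn0 : n ≠ 0 := by
    rintro rfl
    simpa using hn.2
  have hna : ∀ b ∈ A, n a ≤ n b := fun b hb => by simpa using hn.1 b hb
  have hup : Module.finrank ℝ (vectorSpan ℝ (supportFace A n)) < Module.finrank ℤ M := by
    rw [← Module.finrank_baseChange (R := ℝ) (S := ℤ) (M' := M)]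
    apply Submodule.finrank_lt
    intro h
    have hle : vectorSpan ℝ (supportFace A n) ≤ LinearMap.ker (realFunctional n) := by
      rw [vectorSpan_supportFace ha.1 hna, Submodule.span_le]
      rintro _ ⟨_, ⟨b, hb, hba, rfl⟩, rfl⟩
      simp [realFunctional_latticePoint, hba]
    rw [h] at hle
    have : realFunctional n (latticePoint (p - a)) = 0 := hle trivial
    rw [realFunctional_latticePoint] at this
    exact hn.2.ne' (by exact_mod_cast this)
  have hrank : Module.finrank ℝ (vectorSpan ℝ (supportFace A n)) + 1 = Module.finrank ℤ M := by
    by_contra hne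
    obtain ⟨n', h1, h2, h3, b, hb, hb1, hb2⟩ :=
      exists_more_tight hA ha.1 hn.1 hn.2 (by omega)
    refine hmin n' ⟨h1, h2⟩ ?_
    have hss : tight n ⊂ tight n' := by
      refine Finset.ssubset_iff_of_subset (fun c hc => ?_) |>.2
        ⟨b, Finset.mem_filter.2 ⟨hb, hb2⟩, fun h => hb1 (Finset.mem_filter.1 h).2⟩
      obtain ⟨hcA, hc⟩ := Finset.mem_filter.1 hc
      exact Finset.mem_filter.2 ⟨hcA, h3 c hcA hc⟩
    have h4 := Finset.card_lt_card hss
    have h5 := Finset.card_le_card (Finset.filter_subset (fun b => n' (b - a) = 0) A)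
    change A.card - (tight n').card < A.card - (tight n).card
    have h6 : (tight n').card ≤ A.card := h5
    omega
  obtain ⟨k, n', hk, rfl, hprim⟩ := exists_eq_smul_primitive hn0
  have hface : supportFace A n' = supportFace A (k • n') := by
    have hk' : (0 : ℝ) < k := by exact_mod_cast hk
    have : ∀ q, realFunctional (k • n') q = k * realFunctional n' q := by
      intro q
      simp [realFunctional]
    ext q
    simp only [supportFace, this, mul_le_mul_iff_right₀ hk']
  refine ⟨⟨n', hprim, by rw [hface]; exact hrank⟩, fun b hb => ?_, ?_⟩
  · exact (mul_le_mul_iff_right₀ hk).1 (by simpa using hna b hb)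
  · exact (mul_lt_mul_iff_right₀ hk).1 (by simpa [mul_sub] using hn.2)

/-- A vertex is the only point that lies on all facets through it. -/
lemma IsVertex.eq_of_forall_facet {A : Finset M} (hA : affineSpan ℝ (polytope A) = ⊤) {a : M}
    (ha : IsVertex A a) {p : RealSpan M} (hp : p ∈ polytope A)
    (h : ∀ F : FacetNormal A, (∀ b ∈ A, F.1 a ≤ F.1 b) → realFunctional F.1 ∈ normalCone A p) :
    p = latticePoint a := by
  obtain ⟨w, hw0, hw1, rfl⟩ := exists_weights hp
  -- A facet through `a` missing `b` is minimal at the convex combination, which forces the weight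
  -- of `b` to be zero.
  have hw : ∀ b : A, b.1 ≠ a → w b = 0 := by
    intro b hb
    obtain ⟨F, hF, hFb⟩ := ha.exists_facet hA b.2 hb
    have h1 := normalCone_le (h F hF) ha.1
    rw [realFunctional_eq_sum] at h1
    have h2 : ∑ c : A, w c * ((F.1 c : ℝ) - F.1 a) = 0 := by
      apply le_antisymm
      · simp only [mul_sub, Finset.sum_sub_distrib, ← Finset.sum_mul, hw1]
        linarith
      · exact Finset.sum_nonneg fun c _ => mul_nonneg (hw0 c)
          (sub_nonneg.2 (by exact_mod_cast hF _ c.2))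
    have h3 := (Finset.sum_eq_zero_iff_of_nonneg fun c _ => mul_nonneg (hw0 c)
          (sub_nonneg.2 (by exact_mod_cast hF _ c.2))).1 h2 b (Finset.mem_univ _)
    refine (mul_eq_zero.1 h3).resolve_right (sub_ne_zero.2 ?_)
    exact_mod_cast hFb.ne'
  have hwa : w ⟨a, ha.1⟩ = 1 := by
    rw [← hw1]
    refine (Fintype.sum_eq_single _ fun b hb => hw b fun h => hb (Subtype.ext h)).symm
  rw [Fintype.sum_eq_single ⟨a, ha.1⟩, hwa, one_smul]
  intro b hb
  rw [hw b fun h => hb (Subtype.ext h), zero_smul]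

end Polyhedral

/-! ### A flatness criterion for hypersurfaces by lowest weight. -/

section FlatQuotient

variable {R σ : Type*} [CommRing R]

/-- If a coefficient of strictly minimal weight of `f` is a unit, then `f` is a nonzerodivisor
modulo every ideal of the ring of coefficients. -/
lemma mem_map_C_of_mul_mem {f g : MvPolynomial σ R} (w : σ → ℕ) (e : σ →₀ ℕ)
    (he : IsUnit (f.coeff e))
    (hw : ∀ i, f.coeff i ≠ 0 → i ≠ e → Finsupp.weight w e < Finsupp.weight w i)
    (I : Ideal R) (hfg : f * g ∈ I.map MvPolynomial.C) : g ∈ I.map MvPolynomial.C := by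
  classical
  rw [MvPolynomial.mem_map_C_iff] at hfg ⊢
  suffices h : ∀ (k : ℕ) (m : σ →₀ ℕ), Finsupp.weight w m = k → g.coeff m ∈ I from
    fun m => h _ m rfl
  intro k
  induction k using Nat.strong_induction_on with
  | _ k ih =>
    intro m hm
    have h := hfg (e + m)
    have hmem : (e, m) ∈ Finset.HasAntidiagonal.antidiagonal (e + m) := by
      simp [Finset.HasAntidiagonal.mem_antidiagonal]
    rw [MvPolynomial.coeff_mul, ← Finset.add_sum_erase _ _ hmem] at h
    -- In every other product with a nonzero coefficient of `f`, that coefficient has weight above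
    -- that of `e`, so the coefficient of `g` has weight below that of `m` and the induction
    -- hypothesis applies.
    have h2 : ∑ x ∈ (Finset.HasAntidiagonal.antidiagonal (e + m)).erase (e, m), f.coeff x.1 * g.coeff x.2 ∈ I := by
      refine I.sum_mem fun x hx => ?_
      obtain ⟨hne, hx⟩ := Finset.mem_erase.1 hx
      rw [Finset.HasAntidiagonal.mem_antidiagonal] at hx
      by_cases h0 : f.coeff x.1 = 0
      · simp [h0]
      · have hxe : x.1 ≠ e := by
          rintro rfl
          exact hne (Prod.ext rfl (add_left_cancel hx))
        have h3 := hw _ h0 hxe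
        have h4 := congrArg (Finsupp.weight w) hx
        rw [map_add, map_add] at h4
        exact I.mul_mem_left _ (ih _ (by omega) _ rfl)
    have h3 := (Submodule.add_mem_iff_left _ h2).1 h
    exact (Ideal.unit_mul_mem_iff_mem I he).1 h3

/-- A hypersurface in an affine space is flat over the base if its equation has a unit as a
coefficient of strictly minimal weight. -/
lemma flat_quotient_span_singleton {f : MvPolynomial σ R} (w : σ → ℕ) (e : σ →₀ ℕ)
    (he : IsUnit (f.coeff e))
    (hw : ∀ i, f.coeff i ≠ 0 → i ≠ e → Finsupp.weight w e < Finsupp.weight w i) :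
    Module.Flat R (MvPolynomial σ R ⧸ Ideal.span {f}) := by
  refine Module.Flat.iff_forall_isTrivialRelation.2 fun {l r x} hx => ?_
  choose s hs using fun i => Ideal.Quotient.mk_surjective (x i)
  have h1 : ∑ i, r i • s i ∈ Ideal.span {f} := by
    rw [← Ideal.Quotient.eq_zero_iff_mem, ← hx, map_sum]
    refine Finset.sum_congr rfl fun i _ => ?_
    rw [← hs i]
    rfl
  obtain ⟨g, hg⟩ := Ideal.mem_span_singleton'.1 h1
  -- Equational criterion: a relation in the quotient lifts to `∑ r i • s i = g * f`. Since `f` is a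
  -- nonzerodivisor modulo the ideal of the `r i`, the factor `g` is a combination of them, and
  -- correcting each `s i` by a multiple of `f` gives a relation in the polynomial ring itself,
  -- which is flat.
  have h2 : g ∈ (Ideal.span (Set.range r)).map MvPolynomial.C := by
    refine mem_map_C_of_mul_mem w e he hw _ ?_
    rw [mul_comm, hg]
    refine Ideal.sum_mem _ fun i _ => ?_
    rw [MvPolynomial.smul_eq_C_mul]
    exact Ideal.mul_mem_right _ _ (Ideal.mem_map_of_mem _ (Ideal.subset_span ⟨i, rfl⟩))
  rw [Ideal.map_span, ← Set.range_comp] at h2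
  obtain ⟨t, ht⟩ := (Ideal.mem_span_range_iff_exists_fun).1 h2
  have h3 : ∑ i, r i • (s i - t i * f) = 0 := by
    simp only [smul_sub, Finset.sum_sub_distrib, ← hg, ← ht, Finset.sum_mul]
    rw [sub_eq_zero]
    refine Finset.sum_congr rfl fun i _ => ?_
    rw [MvPolynomial.smul_eq_C_mul, Function.comp_apply]
    ring
  obtain ⟨k, a, y, h4, h5⟩ := Module.Flat.isTrivialRelation_of_sum_smul_eq_zero h3
  refine ⟨k, a, fun j => Ideal.Quotient.mk _ (y j), fun i => ?_, h5⟩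
  have h6 : x i = Ideal.Quotient.mk _ (s i - t i * f) := by
    rw [map_sub, hs, map_mul, Ideal.Quotient.eq_zero_iff_mem.2 (Ideal.mem_span_singleton_self f),
      mul_zero, sub_zero]
  rw [h6]
  refine (congrArg _ (h4 i)).trans ?_
  rw [map_sum]
  rfl

end FlatQuotient

/-! ### The universal equation on a stratum. -/

section Equation

variable {M : Type} [AddCommGroup M] [Module.Free ℤ M] [Module.Finite ℤ M] {A : Finset M}

omit [Module.Free ℤ M] [Module.Finite ℤ M] in
lemma facetDistance_eq_zero_iff {F : FacetNormal A} {a : M} (ha : a ∈ A) :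
    facetDistance A F a = 0 ↔ ∀ b ∈ A, F.1 a ≤ F.1 b := by
  have h := cast_facetDistance F ha
  have hbdd : BddBelow (Set.range fun b : A => F.1 b.1) := (Set.finite_range _).bddBelow
  have : Nonempty A := ⟨⟨a, ha⟩⟩
  constructor
  · intro h0 b hb
    rw [h0] at h
    have := ciInf_le hbdd ⟨b, hb⟩
    simp only at this
    push_cast at h
    linarith
  · intro hmin
    have h1 : F.1 a ≤ ⨅ b : A, F.1 b := le_ciInf fun b => hmin b b.2
    have h2 := ciInf_le hbdd ⟨a, ha⟩
    simp only at h2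
    have : (facetDistance A F a : ℤ) = 0 := by linarith
    exact_mod_cast this

variable {R : Type} [CommRing R] (J : Set (FacetNormal A)) (c : A → R)

open Classical in
/-- The coordinate `x_F` on the intersection of the divisors in `J`. -/
def stratumCoord (R : Type) [CommRing R] (F : FacetNormal A) :
    MvPolynomial {F : FacetNormal A // F ∉ J} R :=
  if h : F ∈ J then 0 else MvPolynomial.X ⟨F, h⟩

/-- The equation of the universal section on the intersection of the divisors in `J`. -/
def stratumEquation : MvPolynomial {F : FacetNormal A // F ∉ J} R :=
  letI := Fintype.ofFinite (FacetNormal A)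
  ∑ a : A, MvPolynomial.C (c a) * ∏ F, stratumCoord J R F ^ facetDistance A F a.1

/-- The exponent of `s_a` on the intersection of the divisors in `J`. -/
def stratumExponent (a : M) : {F : FacetNormal A // F ∉ J} →₀ ℕ :=
  Finsupp.equivFunOnFinite.symm fun F => facetDistance A F.1 a

variable {J}

/-- A facet of `J` missing `a` contributes a positive power of zero; one through `a` contributes a
zeroth power. -/
lemma prod_stratumCoord [Fintype (FacetNormal A)] {a : M} (ha : a ∈ A) :
    ∏ F, stratumCoord J R F ^ facetDistance A F a =
      open Classical in if ∀ F ∈ J, ∀ b ∈ A, F.1 a ≤ F.1 b then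
        MvPolynomial.monomial (stratumExponent J a) 1 else 0 := by
  classical
  split_ifs with h
  · rw [MvPolynomial.monomial_eq, MvPolynomial.C_1, one_mul,
      Finsupp.prod_fintype _ _ fun i => pow_zero _]
    rw [← Fintype.prod_subtype_mul_prod_subtype (fun F => F ∈ J)]
    rw [Finset.prod_eq_one, one_mul]
    · refine Finset.prod_congr (by ext; simp) fun F _ => ?_
      simp [stratumCoord, F.2, stratumExponent]
    · intro F _
      rw [(facetDistance_eq_zero_iff ha).2 (h F.1 F.2), pow_zero]
  · push Not at h
    obtain ⟨F, hF, b, hb, hlt⟩ := h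
    refine Finset.prod_eq_zero (Finset.mem_univ F) ?_
    rw [stratumCoord, dif_pos hF, zero_pow]
    exact fun h0 => hlt.not_ge ((facetDistance_eq_zero_iff ha).1 h0 b hb)

lemma coeff_stratumEquation (e : {F : FacetNormal A // F ∉ J} →₀ ℕ) :
    (stratumEquation J c).coeff e = open Classical in
      ∑ a : A, if (∀ F ∈ J, ∀ b ∈ A, F.1 a.1 ≤ F.1 b) ∧ stratumExponent J a.1 = e
        then c a else 0 := by
  classical
  let := Fintype.ofFinite (FacetNormal A)
  rw [stratumEquation, MvPolynomial.coeff_sum]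
  refine Finset.sum_congr rfl fun a _ => ?_
  rw [MvPolynomial.coeff_C_mul, prod_stratumCoord a.2]
  split_ifs with h1 h2 h2 <;> simp_all [MvPolynomial.coeff_monomial]

/-- The incidence variety in the intersection of the divisors in `J` is flat over the
coefficients. -/
lemma flat_stratum (hA : affineSpan ℝ (polytope A) = ⊤) (hc : ∀ a : A, IsVertex A a.1 → IsUnit (c a))
    {p : RealSpan M} (hp : p ∈ polytope A)
    (hJ : ∀ F ∈ J, realFunctional F.1 ∈ normalCone A p) :
    Module.Flat R (MvPolynomial {F : FacetNormal A // F ∉ J} R ⧸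
      Ideal.span {stratumEquation J c}) := by
  classical
  obtain ⟨a, ha, haJ⟩ := exists_isVertex_of_mem_normalCone (Subtype.val '' J) hp
    (by rintro _ ⟨F, hF, rfl⟩; exact hJ F hF)
  have haJ' : ∀ F ∈ J, ∀ b ∈ A, F.1 a ≤ F.1 b := fun F hF => haJ _ ⟨F, hF, rfl⟩
  -- Only facets through `a` carry weight, so the weight of an exponent measures the distance from
  -- these facets and vanishes only for `a` among the surviving elements of `A`.
  let w : {F : FacetNormal A // F ∉ J} → ℕ := fun F => if facetDistance A F.1 a = 0 then 1 else 0
  let := Fintype.ofFinite {F : FacetNormal A // F ∉ J}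
  have hweight : ∀ b, Finsupp.weight w (stratumExponent J b) =
      ∑ F, facetDistance A F.1 b * w F := by
    intro b
    rw [Finsupp.weight_apply, Finsupp.sum_fintype _ _ (by simp)]
    rfl
  have hw0 : Finsupp.weight w (stratumExponent J a) = 0 := by
    rw [hweight]
    refine Finset.sum_eq_zero fun F _ => ?_
    simp only [w]
    split_ifs with h <;> simp [h]
  have hwpos : ∀ b ∈ A, b ≠ a → (∀ F ∈ J, ∀ c ∈ A, F.1 b ≤ F.1 c) →
      0 < Finsupp.weight w (stratumExponent J b) := by
    intro b hb hba hbJ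
    obtain ⟨F, hF, hlt⟩ := ha.exists_facet hA hb hba
    -- Since `b` lies on all facets of `J`, the facet separating it from `a` is one whose coordinate
    -- remains a variable.
    have hFJ : F ∉ J := fun h => hlt.not_ge (hbJ F h a ha.1)
    rw [hweight]
    refine Finset.sum_pos' (fun _ _ => Nat.zero_le _) ⟨⟨F, hFJ⟩, Finset.mem_univ _, ?_⟩
    have h1 : facetDistance A F a = 0 := (facetDistance_eq_zero_iff ha.1).2 hF
    have h2 : facetDistance A F b ≠ 0 := fun h0 =>
      hlt.not_ge ((facetDistance_eq_zero_iff hb).1 h0 a ha.1)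
    simp only [w, h1, if_true, mul_one]
    omega
  refine flat_quotient_span_singleton w (stratumExponent J a) ?_ ?_
  · rw [coeff_stratumEquation, Finset.sum_eq_single ⟨a, ha.1⟩]
    · rw [if_pos ⟨haJ', rfl⟩]
      exact hc _ ha
    · intro b _ hb
      rw [if_neg]
      rintro ⟨h1, h2⟩
      have := hwpos b.1 b.2 (fun h => hb (Subtype.ext h)) h1
      rw [h2, hw0] at this
      exact this.ne rfl
    · exact fun h => absurd (Finset.mem_univ _) h
  · intro i hi hne
    rw [coeff_stratumEquation] at hi
    obtain ⟨b, -, hb⟩ := Finset.exists_ne_zero_of_sum_ne_zero hi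
    obtain ⟨⟨h1, rfl⟩, -⟩ := ite_ne_right_iff.1 hb
    rw [hw0]
    exact hwpos b.1 b.2 (fun h => hne (by rw [h])) h1

end Equation

/-! ### Morphisms to affine schemes. -/

section AffineTarget

lemma toSpecΓ_SpecMap_appTop {X : Scheme.{0}} {R : CommRingCat.{0}} (φ : R ⟶ Γ(X, ⊤)) (r : R) :
    (X.toSpecΓ ≫ Spec.map φ).appTop.hom ((Scheme.ΓSpecIso R).inv.hom r) = φ.hom r := by
  rw [Scheme.Hom.comp_appTop, Scheme.toSpecΓ_appTop]
  refine (congrArg _ (appTop_SpecMap φ r)).trans ?_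
  exact congr(($((Scheme.ΓSpecIso Γ(X, ⊤)).inv_hom_id)).hom (φ.hom r))

lemma hom_ext_Spec {X : Scheme.{0}} {R : CommRingCat.{0}} {f g : X ⟶ Spec R}
    (h : ∀ r, f.appTop.hom ((Scheme.ΓSpecIso R).inv.hom r) =
      g.appTop.hom ((Scheme.ΓSpecIso R).inv.hom r)) : f = g := by
  refine ext_of_isAffine ?_
  rw [← cancel_epi (Scheme.ΓSpecIso R).inv]
  ext r
  exact h r

lemma isoSpec_inv_appTop_apply {X : Scheme.{0}} [IsAffine X] (r : Γ(X, ⊤)) :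
    X.isoSpec.inv.appTop.hom r = (Scheme.ΓSpecIso _).inv.hom r := by
  refine (ConcreteCategory.bijective_of_isIso (Scheme.ΓSpecIso Γ(X, ⊤)).hom).1 ?_
  have h := congr(($(congrArg Scheme.Hom.appTop X.isoSpec.hom_inv_id)).hom r)
  rw [Scheme.Hom.comp_appTop, Scheme.isoSpec_hom, Scheme.toSpecΓ_appTop] at h
  exact Eq.trans h congr(($((Scheme.ΓSpecIso Γ(X, ⊤)).inv_hom_id)).hom r).symm

end AffineTarget

/-! ### The scheme of incident pairs. -/

section FullAtlas

variable {M : Type} [AddCommGroup M] [Module.Free ℤ M] [Module.Finite ℤ M] {A : Finset M}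

-- The locus is the basic open set of the product of the vertex coefficients in an affine scheme.
omit [Module.Free ℤ M] [Module.Finite ℤ M] in
lemma isAffineOpen_fullSections : IsAffineOpen (fullSections A) := by
  classical
  let S := {a : A // IsVertex A a.1}
  let : Fintype S := Fintype.ofFinite S
  have h : ∀ t : Finset S, t.inf (fun a => (linearSystem A).basicOpen
      (AffineSpace.coord baseScheme a.1)) =
      (linearSystem A).basicOpen (∏ a ∈ t, AffineSpace.coord baseScheme a.1) := by
    intro t
    induction t using Finset.induction_on with
    | empty => simp [Scheme.basicOpen_of_isUnit]
    | insert a t ha ih => rw [Finset.inf_insert, ih, Finset.prod_insert ha, Scheme.basicOpen_mul]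
  have h2 := h Finset.univ
  rw [Finset.inf_univ_eq_iInf] at h2
  rw [fullSections, h2]
  exact (isAffineOpen_top _).basicOpen _

instance : IsAffine (openScheme (fullSections A)).left := isAffineOpen_fullSections

omit [Module.Free ℤ M] [Module.Finite ℤ M] in
lemma isUnit_coeff_fullSections {a : A} (ha : IsVertex A a.1) :
    IsUnit (coeff (fullSections A) a) := by
  refine RingedSpace.isUnit_of_isUnit_germ _ _ _ fun y _ => ?_
  exact (Scheme.mem_basicOpen_top _ _ y).1
    ((openSubscheme_mem_basicOpen a y).2 (mem_fullSections.1 y.2 a ha))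

variable (J : Set (FacetNormal A)) (U : (linearSystem A).Opens)

/-- The coordinate ring of the incidence variety in the intersection of the divisors in `J`. -/
abbrev StratumRing : Type :=
  MvPolynomial {F : FacetNormal A // F ∉ J} Γ((openScheme U).left, ⊤) ⧸
    Ideal.span {stratumEquation J (coeff U)}

variable {J U}

lemma eval_stratumEquation {S : Type} [CommRing S] (φ : Γ((openScheme U).left, ⊤) →+* S)
    (v : FacetNormal A → S) (hv : ∀ F ∈ J, v F = 0) :
    letI := Fintype.ofFinite (FacetNormal A)
    MvPolynomial.eval₂Hom φ (fun F : {F : FacetNormal A // F ∉ J} => v F)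
      (stratumEquation J (coeff U)) =
      ∑ a : A, φ (coeff U a) * ∏ F, v F ^ facetDistance A F a.1 := by
  have h : ∀ F, MvPolynomial.eval₂Hom φ (fun F : {F : FacetNormal A // F ∉ J} => v F)
      (stratumCoord J _ F) = v F := by
    intro F
    rw [stratumCoord]
    split_ifs with hF
    · rw [map_zero, hv F hF]
    · simp
  simp only [stratumEquation, map_sum, map_mul, map_prod, map_pow, h]
  simp

variable [IsAffine (openScheme U).left]

/-- There is a scheme that classifies incident pairs. -/
lemma exists_classifying (hflat : ∀ p ∈ polytope A,
      (∀ F ∈ J, realFunctional F.1 ∈ normalCone A p) →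
      Module.Flat Γ((openScheme U).left, ⊤) (StratumRing J U)) :
    ∃ (T : Over baseScheme) (x : T ⟶ coxScheme A) (s : T ⟶ openScheme U),
      IsIncident J x s ∧ Flat s.left ∧
      (∀ (Y : Over baseScheme) (x' : Y ⟶ coxScheme A) (s' : Y ⟶ openScheme U),
        IsIncident J x' s' → ∃ f : Y ⟶ T, f ≫ x = x' ∧ f ≫ s = s') ∧
      ∀ (Y : Over baseScheme) (f f' : Y ⟶ T), f ≫ x = f' ≫ x → f ≫ s = f' ≫ s → f = f' := by
  let R := Γ((openScheme U).left, ⊤)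
  let N : CommRingCat.{0} := .of (StratumRing J U)
  let ι : R ⟶ N := CommRingCat.ofHom (algebraMap R (StratumRing J U))
  let ξ : FacetNormal A → N := fun F => Ideal.Quotient.mk _ (stratumCoord J R F)
  have hξ : ∀ F ∈ J, ξ F = 0 := fun F hF => by simp [ξ, stratumCoord, hF]
  let σ : Spec N ⟶ (openScheme U).left := Spec.map ι ≫ (openScheme U).left.isoSpec.inv
  let v : FacetNormal A → Γ(Spec N, ⊤) := fun F => (Scheme.ΓSpecIso N).inv.hom (ξ F)
  -- The equations are already imposed in `N`; `W` imposes the open condition that the coordinates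
  -- define a point of U_Q.
  let W : (Spec N).Opens :=
    (AffineSpace.homOfVector (σ ≫ (openScheme U).hom) v) ⁻¹ᵁ coxOpen A
  let T : Over baseScheme := Over.mk (W.ι ≫ σ ≫ (openScheme U).hom)
  let s : T ⟶ openScheme U := Over.homMk (W.ι ≫ σ) (by simp [T])
  let θ : N →+* Γ(T.left, ⊤) := W.ι.appTop.hom.comp (Scheme.ΓSpecIso N).inv.hom
  have hW : ∀ y : Spec N, y ∈ W ↔ ∃ p : polytope A, ∀ F : FacetNormal A,
      realFunctional F.1 ∉ normalCone A p → y ∈ (Spec N).basicOpen (v F) := by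
    intro y
    change AffineSpace.homOfVector _ _ y ∈ coxOpen A ↔ _
    simp only [mem_coxOpen, homOfVector_mem_basicOpen]
  obtain ⟨x, hx⟩ := exists_hom_coxScheme (Y := T) (fun F => θ (ξ F)) (by
    intro y
    obtain ⟨p, hp⟩ := (hW (W.ι y)).1 y.2
    refine ⟨p, fun F hF => ?_⟩
    have := hp F hF
    change y ∈ W.toScheme.basicOpen (W.ι.appTop.hom (v F))
    rw [← Scheme.preimage_basicOpen_top]
    exact this)
  have hs : ∀ r, pull s r = θ (ι.hom r) := by
    intro r
    change (W.ι ≫ Spec.map ι ≫ (openScheme U).left.isoSpec.inv).appTop.hom r = _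
    rw [Scheme.Hom.comp_appTop, Scheme.Hom.comp_appTop]
    refine congrArg W.ι.appTop.hom ?_
    exact (congrArg _ (isoSpec_inv_appTop_apply r)).trans (appTop_SpecMap ι r)
  have hmk : ∀ F ∉ J, ∀ hF, ξ F = Ideal.Quotient.mk _ (MvPolynomial.X ⟨F, hF⟩) :=
    fun F hF _ => by simp [ξ, stratumCoord, hF]
  refine ⟨T, x, s, ⟨?_, ?_⟩, ?_, ?_, ?_⟩
  · let θ' : MvPolynomial {F // F ∉ J} R →+* Γ(T.left, ⊤) := θ.comp (Ideal.Quotient.mk _)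
    have h1 : θ' (stratumEquation J (coeff U)) = 0 := by
      refine (congrArg θ ?_).trans (map_zero θ)
      exact Ideal.Quotient.eq_zero_iff_mem.2 (Ideal.mem_span_singleton_self _)
    rw [← h1, stratumEquation, map_sum]
    simp only [map_mul, map_prod, map_pow]
    refine Finset.sum_congr rfl fun a _ => ?_
    rw [hs, pull_toricSection]
    simp only [hx]
    rfl
  · intro F hF
    rw [hx, hξ F hF, map_zero]
  -- `hflat` asks for a point of the polytope on all facets of `J`. A point of `W` provides one,
  -- because the coordinates of these facets are zero there; for empty `W` flatness is vacuous.
  · by_cases hne : Nonempty W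
    · obtain ⟨y⟩ := hne
      obtain ⟨p, hp⟩ := (hW y.1).1 y.2
      have := hflat p.1 p.2 fun F hF => by
        by_contra h
        have h2 := hp F h
        simp [v, hξ F hF] at h2
      have : Flat (Spec.map ι) := by
        refine Flat.SpecMap_iff.2 ?_
        change (algebraMap R (StratumRing J U)).Flat
        rw [RingHom.flat_algebraMap_iff]
        exact this
      change Flat (W.ι ≫ Spec.map ι ≫ (openScheme U).left.isoSpec.inv)
      infer_instance
    · exact Flat.of_stalkMap _ fun y => (hne ⟨y⟩).elim
  · intro Y x' s' h
    -- The classifying map evaluates the variables at the coordinates of `x'`. Incidence makes it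
    -- factor through the quotient, and the image lies in `W` because `x'` lands in U_Q.
    let φ : MvPolynomial {F // F ∉ J} R →+* Γ(Y.left, ⊤) :=
      MvPolynomial.eval₂Hom (pull s') fun F => pull x' (coxCoord A F.1)
    have hφ : φ (stratumEquation J (coeff U)) = 0 := by
      rw [← h.hypersurface]
      refine (eval_stratumEquation (pull s') (fun F => pull x' (coxCoord A F)) h.divisor).trans ?_
      exact Finset.sum_congr rfl fun a _ => by rw [pull_toricSection]
    let ψ : StratumRing J U →+* Γ(Y.left, ⊤) := Ideal.Quotient.lift _ φ fun a ha => by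
      obtain ⟨b, rfl⟩ := Ideal.mem_span_singleton.1 ha
      rw [map_mul, hφ, zero_mul]
    have hψι : ∀ r, ψ (ι.hom r) = pull s' r := fun r => by
      refine (Ideal.Quotient.lift_mk _ φ _ (a := MvPolynomial.C r)).trans ?_
      exact MvPolynomial.eval₂_C _ _ _
    have hψξ : ∀ F, ψ (ξ F) = pull x' (coxCoord A F) := fun F => by
      by_cases hF : F ∈ J
      · rw [hξ F hF, map_zero, h.divisor F hF]
      · rw [hmk F hF hF]
        refine (Ideal.Quotient.lift_mk _ φ _).trans ?_
        exact MvPolynomial.eval₂_X _ _ _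
    let g : Y.left ⟶ Spec N := Y.left.toSpecΓ ≫ Spec.map (CommRingCat.ofHom ψ)
    have hg : ∀ r, g.appTop.hom ((Scheme.ΓSpecIso N).inv.hom r) = ψ r :=
      toSpecΓ_SpecMap_appTop _
    have hgσ : g ≫ σ = s'.left := by
      refine ext_of_isAffine ?_
      ext r
      change (g ≫ Spec.map ι ≫ (openScheme U).left.isoSpec.inv).appTop.hom r = _
      rw [Scheme.Hom.comp_appTop, Scheme.Hom.comp_appTop]
      refine Eq.trans (congrArg g.appTop.hom
        ((congrArg _ (isoSpec_inv_appTop_apply r)).trans (appTop_SpecMap ι r))) ?_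
      rw [hg]
      exact hψι r
    have hgW : Set.range g ⊆ Set.range W.ι := by
      rintro _ ⟨y, rfl⟩
      rw [Scheme.Opens.range_ι]
      obtain ⟨p, hp⟩ := exists_mem_basicOpen_coxCoord x' y
      refine (hW _).2 ⟨p, fun F hF => ?_⟩
      have := hp F hF
      rw [← hψξ, ← hg, ← Scheme.preimage_basicOpen_top] at this
      exact this
    refine ⟨Over.homMk (IsOpenImmersion.lift W.ι g hgW) ?_, ?_, ?_⟩
    · simp only [T, Over.mk_hom]
      rw [IsOpenImmersion.lift_fac_assoc, ← Category.assoc, hgσ, Over.w]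
    · refine coxScheme_hom_ext fun F => ?_
      rw [pull_comp, hx, ← hψξ, ← hg]
      change (IsOpenImmersion.lift W.ι g hgW).appTop.hom (W.ι.appTop.hom _) = _
      conv_rhs => rw [← IsOpenImmersion.lift_fac W.ι g hgW, Scheme.Hom.comp_appTop]
      rfl
    · apply Over.OverMorphism.ext
      change IsOpenImmersion.lift W.ι g hgW ≫ W.ι ≫ σ = _
      rw [IsOpenImmersion.lift_fac_assoc, hgσ]
  · intro Y f f' h1 h2
    apply Over.OverMorphism.ext
    rw [← cancel_mono W.ι]
    apply hom_ext_Spec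
    have key : (pull f).comp θ = (pull f').comp θ := by
      refine Ideal.Quotient.ringHom_ext (MvPolynomial.ringHom_ext (fun r => ?_) fun F => ?_)
      · have := congrArg (fun k => pull k r) h2
        simp only [pull_comp, hs] at this
        exact this
      · have := congrArg (fun k => pull k (coxCoord A F.1)) h1
        simp only [pull_comp, hx, hmk F.1 F.2 F.2] at this
        exact this
    intro r
    rw [Scheme.Hom.comp_appTop, Scheme.Hom.comp_appTop]
    exact RingHom.congr_fun key r

end FullAtlas

/-! ### Flatness on the full sections and failure of flatness elsewhere. -/

/-- A function on an integral scheme vanishes if its pullback by a flat morphism from a nonempty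
scheme does. -/
lemma eq_zero_of_flat {X Y : Scheme.{0}} (f : X ⟶ Y) [Flat f] [IsIntegral Y] (x : X)
    {r : Γ(Y, ⊤)} (h : f.appTop.hom r = 0) : r = 0 := by
  -- A flat local homomorphism is faithfully flat, hence injective; on an integral scheme one germ
  -- determines the function.
  have hinj : Function.Injective (f.stalkMap x).hom := by
    algebraize [(f.stalkMap x).hom]
    have : Module.FaithfullyFlat (Y.presheaf.stalk (f x)) (X.presheaf.stalk x) :=
      @Module.FaithfullyFlat.of_flat_of_isLocalHom _ _ _ _ _ _ _
        (Flat.stalkMap f x) (f.toLRSHom.prop x)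
    exact ‹RingHom.FaithfullyFlat _›.injective
  refine germ_injective_of_isIntegral Y (U := ⊤) (f x) trivial (hinj ?_)
  rw [map_zero, map_zero]
  refine (Scheme.Hom.germ_stalkMap_apply f ⊤ x trivial r).trans ?_
  exact (congrArg _ h).trans (map_zero _)

section Incidence

variable {M : Type} [AddCommGroup M] [Module.Free ℤ M] [Module.Finite ℤ M] {A : Finset M}

lemma isFlatOver_fullSections (hA : affineSpan ℝ (polytope A) = ⊤) (J : Set (FacetNormal A)) :
    IsFlatOver (incidenceProj A J (fullSections A)) := by
  obtain ⟨T, x, s, h, hflat, hex, huniq⟩ := exists_classifying (J := J) (U := fullSections A)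
    fun p hp hJ => flat_stratum _ hA (fun a ha => isUnit_coeff_fullSections ha) hp hJ
  exact ⟨_, IncidenceStack.isAtlas_ofHom h hex huniq, hflat⟩

variable (A) in
omit [AddCommGroup M] [Module.Free ℤ M] [Module.Finite ℤ M] in
lemma coord_ne_zero (a : A) : AffineSpace.coord baseScheme a ≠ 0 := by
  intro h
  have h1 := AffineSpace.homOfVector_appTop_coord (𝟙 baseScheme) (fun _ : A => 1) a
  rw [h, map_zero] at h1
  exact zero_ne_one h1

variable {U : (linearSystem A).Opens} {a : A}

/-- On the stratum of a vertex `a` only the section `s_a` does not vanish. -/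
lemma pull_toricSection_eq_zero (hA : affineSpan ℝ (polytope A) = ⊤) (ha : IsVertex A a.1)
    {Y : Over baseScheme} {x : Y ⟶ coxScheme A}
    (hx : ∀ F : FacetNormal A, (∀ b ∈ A, F.1 a.1 ≤ F.1 b) → pull x (coxCoord A F) = 0)
    {b : M} (hb : b ∈ A) (hba : b ≠ a.1) : pull x (toricSection A b) = 0 := by
  obtain ⟨F, hF, hlt⟩ := ha.exists_facet hA hb hba
  rw [pull_toricSection]
  let := Fintype.ofFinite (FacetNormal A)
  refine Finset.prod_eq_zero (Finset.mem_univ F) ?_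
  rw [hx F hF, zero_pow]
  exact fun h0 => hlt.not_ge ((facetDistance_eq_zero_iff hb).1 h0 a.1 a.2)

/-- When all coordinates of the facets through `a` vanish, the open condition of U_Q can only hold
with the vertex itself as the point of the polytope. So the other coordinates, the only ones
occurring in s_a, are invertible. -/
lemma isUnit_pull_toricSection (hA : affineSpan ℝ (polytope A) = ⊤) (ha : IsVertex A a.1)
    {Y : Over baseScheme} {x : Y ⟶ coxScheme A}
    (hx : ∀ F : FacetNormal A, (∀ b ∈ A, F.1 a.1 ≤ F.1 b) → pull x (coxCoord A F) = 0) :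
    IsUnit (pull x (toricSection A a.1)) := by
  refine RingedSpace.isUnit_of_isUnit_germ _ _ _ fun y _ => ?_
  obtain ⟨p, hp⟩ := exists_mem_basicOpen_coxCoord x y
  have hpa : p.1 = latticePoint a.1 := by
    refine ha.eq_of_forall_facet hA p.2 fun F hF => ?_
    by_contra h
    have := hp F h
    rw [hx F hF, Scheme.basicOpen_zero] at this
    exact this
  rw [pull_toricSection, map_prod]
  refine (IsUnit.prod_iff).2 fun F _ => ?_
  rw [map_pow]
  by_cases h0 : facetDistance A F a.1 = 0
  · rw [h0, pow_zero]
    exact isUnit_one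
  · refine IsUnit.pow _ ((Scheme.mem_basicOpen_top _ _ y).1 (hp F ?_))
    rw [hpa, mem_normalCone_latticePoint]
    exact fun h => h0 ((facetDistance_eq_zero_iff a.2).2 h)

/-- If the coefficient of a vertex `a` vanishes at a point `u`, then the fibre over `u` of the
incidence stack of the facets through `a` is not empty. -/
lemma exists_isIncident (hA : affineSpan ℝ (polytope A) = ⊤) (ha : IsVertex A a.1)
    {u : (openScheme U).left} (hu : u ∉ (openScheme U).left.basicOpen (coeff U a)) :
    ∃ (T : Over baseScheme) (x : T ⟶ coxScheme A) (s : T ⟶ openScheme U),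
      IsIncident {F : FacetNormal A | ∀ b ∈ A, F.1 a.1 ≤ F.1 b} x s ∧ Nonempty T.left := by
  classical
  let T : Over baseScheme :=
    Over.mk ((openScheme U).left.fromSpecResidueField u ≫ (openScheme U).hom)
  let s : T ⟶ openScheme U := Over.homMk ((openScheme U).left.fromSpecResidueField u)
  have hs : ∀ t, s.left t = u := Scheme.fromSpecResidueField_apply u
  -- Over the residue field of `u`, take the point with coordinate 0 for the facets through `a` and
  -- 1 for the others.
  obtain ⟨x, hx⟩ := exists_hom_coxScheme (Y := T) (A := A)
    (fun F => if ∀ b ∈ A, F.1 a.1 ≤ F.1 b then 0 else 1) fun y =>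
      ⟨⟨latticePoint a.1, latticePoint_mem_polytope a.2⟩, fun F hF => by
        rw [mem_normalCone_latticePoint] at hF
        rw [if_neg hF, Scheme.basicOpen_of_isUnit _ isUnit_one]
        trivial⟩
  have hx0 : ∀ F : FacetNormal A, (∀ b ∈ A, F.1 a.1 ≤ F.1 b) → pull x (coxCoord A F) = 0 :=
    fun F hF => by rw [hx, if_pos hF]
  have : IsReduced T.left :=
    inferInstanceAs (IsReduced (Spec ((openScheme U).left.residueField u)))
  refine ⟨T, x, s, ⟨Finset.sum_eq_zero fun b _ => ?_, hx0⟩,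
    ⟨IsLocalRing.closedPoint ((openScheme U).left.residueField u)⟩⟩
  by_cases hba : b = a
  · have h0 : pull s (coeff U b) = 0 := by
      -- On a reduced scheme a function with empty nonvanishing locus is zero.
      rw [← basicOpen_eq_bot_iff, eq_bot_iff]
      intro t ht
      rw [mem_basicOpen_pull, hs, hba] at ht
      exact hu ht
    rw [h0, zero_mul]
  · rw [pull_toricSection_eq_zero hA ha hx0 b.2 fun h => hba (Subtype.ext h), mul_zero]

lemma mem_basicOpen_coeff_of_isFlatOver (hA : affineSpan ℝ (polytope A) = ⊤)
    (ha : IsVertex A a.1)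
    (h : IsFlatOver (incidenceProj A {F : FacetNormal A | ∀ b ∈ A, F.1 a.1 ≤ F.1 b} U))
    (u : (openScheme U).left) : u ∈ (openScheme U).left.basicOpen (coeff U a) := by
  by_contra hu
  obtain ⟨E, hE, hflat⟩ := h
  obtain ⟨T, x, s, hinc, ⟨t⟩⟩ := exists_isIncident hA ha hu
  -- The product of the unknown atlas `E` with a nonempty object covers that object, so `E` itself
  -- is nonempty.
  obtain ⟨c, -, -, hsurj, -⟩ := hE (IncidenceStack.ofHom hinc)
  obtain ⟨z, -⟩ := hsurj.surj t
  have := E.point.isPrincipalBundle.surjective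
  obtain ⟨y, -⟩ := E.point.proj.left.surjective
    (((incidenceProj A _ U).map c.fst).left z)
  -- Only the term of `a` survives in the equation, and its section is a unit, so the coefficient
  -- pulls back to zero.
  have hzero : pull (E.point.proj ≫ E.sec) (coeff U a) = 0 := by
    have h1 := E.mem_hypersurface
    rw [Finset.sum_eq_single a] at h1
    · exact (isUnit_pull_toricSection hA ha E.mem_divisor).mul_left_eq_zero.1 h1
    · intro b _ hba
      rw [pull_toricSection_eq_zero hA ha E.mem_divisor b.2 fun h => hba (Subtype.ext h), mul_zero]
    · exact fun h => absurd (Finset.mem_univ _) h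
  have h1 : Flat E.point.proj.left := E.point.isPrincipalBundle.flat
  have h2 : Flat E.sec.left := hflat
  let q : E.point.total.left ⟶ U := E.point.proj.left ≫ E.sec.left
  have hq : Flat q := inferInstanceAs (Flat (E.point.proj.left ≫ E.sec.left))
  -- The composite to the whole linear system is still flat, and there the target is integral and
  -- the coordinate is nonzero.
  refine coord_ne_zero A a (eq_zero_of_flat (q ≫ U.ι) y ?_)
  rw [Scheme.Hom.comp_appTop]
  exact hzero

lemma le_fullSections (hA : affineSpan ℝ (polytope A) = ⊤)
    (h : ∀ J : Set (FacetNormal A), IsFlatOver (incidenceProj A J U)) : U ≤ fullSections A :=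
  fun u hu => mem_fullSections.2 fun a ha =>
    (openSubscheme_mem_basicOpen a _).1 (mem_basicOpen_coeff_of_isFlatOver hA ha (h _) ⟨u, hu⟩)

end Incidence

end ToricIncidence

end

theorem mainTheorem9 {M : Type} [AddCommGroup M] [Module.Free ℤ M] [Module.Finite ℤ M]
    (A : Finset M) (hA : affineSpan ℝ (ToricIncidence.polytope A) = ⊤) :
    IsGreatest
      {U : (ToricIncidence.linearSystem A).Opens |
        ∀ J : Set (ToricIncidence.FacetNormal A),
          ToricIncidence.IsFlatOver (ToricIncidence.incidenceProj A J U)}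
      (ToricIncidence.fullSections A) :=
  ⟨ToricIncidence.isFlatOver_fullSections hA, fun _ hU => ToricIncidence.le_fullSections hA hU⟩
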